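/- Let $\mathbf k$ be a field of characteristic zero and let $(\mathfrak g,\mathfrak g^*)$ be a finite-dimensional Lie bialgebra over $\mathbf k$: $\mathfrak g$ and $\mathfrak g^*$ are Lie algebras and the map $\delta:\mathfrak g\to\wedge^2\mathfrak g$ dual to the bracket of $\mathfrak g^*$ is a $1$-cocycle with values in the adjoint representation. The spaces $\wedge^n\mathfrak g^*$ and $(\wedge^n\mathfrak g)^*$ are identified by $\langle\alpha_1\wedge\dots\wedge\alpha_n,\,x_1\wedge\dots\wedge x_n\rangle=\det(\alpha_j(x_i))$. **The complex of the Lie bialgebra.** Put $C^0_{\mathrm{LieBi}}=0$ and $C^n_{\mathrm{LieBi}}=\bigoplus_{p+q=n+1,\;p,q\ge1}\mathrm{Hom}(\wedge^p\mathfrak g,\wedge^q\mathfrak g)$ for $n\ge1$, with $\delta_{\mathrm{LieBi}}=\delta_{\mathfrak g}+\delta_{\mathfrak g^*}$. Here $\delta_{\mathfrak g}:\mathrm{Hom}(\wedge^p\mathfrak g,\wedge^q\mathfrak g)\to\mathrm{Hom}(\wedge^{p+1}\mathfrak g,\wedge^q\mathfrak g)$ is the Chevalley–Eilenberg coboundary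 of $\mathfrak g$ with coefficients in the adjoint representation on $\wedge^q\mathfrak g$. The map $\delta_{\mathfrak g^*}:\mathrm{Hom}(\wedge^p\mathfrak g,\wedge^q\mathfrak g)\to\mathrm{Hom}(\wedge^{p}\mathfrak g,\wedge^{q+1}\mathfrak g)$ is the Chevalley–Eilenberg coboundary of $\mathfrak g^*$ with coefficients in the adjoint representation on $\wedge^p\mathfrak g^*$, transported along the identification $\mathrm{Hom}(\wedge^p\mathfrak g,\wedge^q\mathfrak g)\cong\mathrm{Hom}(\wedge^q\mathfrak g^*,\wedge^p\mathfrak g^*)$, $\xi\mapsto\xi^*$, given by $\langle\xi^*(Y),X\rangle=(-1)^{pq}\langle Y,\xi(X)\rangle$. **The complex of the matched pair.** Let $\rho=\mathrm{ad}^*_{\mathfrak g}$ and $\psi=\mathrm{ad}^*_{\mathfrak g^*}$ be the coadjoint actions, $(\rho_x\alpha)(y)=-\alpha([x,y])$ and $\beta(\psi_\alpha x)=-[\alpha,\beta](x)$. Let $\pi$ be the map $$\pi((x,\alpha),(y,\beta))=\big([x,y]+\psi_\alpha y-\psi_\beta x,\;[\alpha,\beta]+\rho_x\beta-\rho_y\alpha\big)$$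 on $\mathfrak g\oplus\mathfrak g^*$. For $k,l\ge0$ let $C^{k|l}$ be the space of alternating $(k+l+1)$-linear maps $f$ on $\mathfrak g\oplus\mathfrak g^*$ with values in $\mathfrak g\oplus\mathfrak g^*$ such that $f(\wedge^{k+1}\mathfrak g\otimes\wedge^l\mathfrak g^*)\subset\mathfrak g$, $f(\wedge^{k}\mathfrak g\otimes\wedge^{l+1}\mathfrak g^*)\subset\mathfrak g^*$, and $f=0$ on the other summands of $\wedge^{k+l+1}(\mathfrak g\oplus\mathfrak g^*)=\bigoplus_{a+b=k+l+1}\wedge^a\mathfrak g\otimes\wedge^b\mathfrak g^*$. Put $C^n_{\mathrm{MPL}}=C^{n-1|0}\oplus\dots\oplus C^{0|n-1}$ and $\delta_{\mathrm{MPL}}(F)=-[\pi,F]_{\mathrm{NR}}$ for $n\ge1$, where $[\,,]_{\mathrm{NR}}$ is the Nijenhuis–Richardson bracket: for $f$ in $m+1$ and $g$ in $n+1$ arguments, $[f,g]_{\mathrm{NR}}=i_fg-(-1)^{mn}i_gf$ with $$(i_fg)(x_1,\dots,x_{m+n+1})=\sum_{\sigma\in\mathrm{Sh}(m+1,n)}(-1)^\sigma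 g\big(f(x_{\sigma(1)},\dots,x_{\sigma(m+1)}),x_{\sigma(m+2)},\dots,x_{\sigma(m+n+1)}\big).$$ For $n=0$ put $\delta_{\mathrm{MPL}}(u)(v)=-\pi(u,v)$, and let $C^0_{\mathrm{MPL}}$ be the space of those $u\in\mathfrak g\oplus\mathfrak g^*$ for which $\delta_{\mathrm{MPL}}(u)\in C^{0|0}=C^1_{\mathrm{MPL}}$. **The map $\Psi$.** For $\xi\in\mathrm{Hom}(\wedge^p\mathfrak g,\wedge^q\mathfrak g)$, $p,q\ge1$, define $\widetilde\xi:\wedge^p\mathfrak g\otimes\wedge^{q-1}\mathfrak g^*\to\mathfrak g$ and $\overline\xi:\wedge^{p-1}\mathfrak g\otimes\wedge^{q}\mathfrak g^*\to\mathfrak g^*$ by $$\alpha\big(\widetilde\xi(X\otimes Y)\big)=\langle Y\wedge\alpha,\,\xi(X)\rangle,\qquad \overline\xi(X\otimes Y)(x)=(-1)^{(p-1)q}\langle\xi^*(Y),\,X\wedge x\rangle .$$ Extend both to alternating maps on $\mathfrak g\oplus\mathfrak g^*$ (by zero on the other summands of $\wedge^{p+q-1}(\mathfrak g\oplus\mathfrak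 g^*)$, where $X\otimes Y$ stands for $X\wedge Y$), and put $\Psi(\xi)=\widetilde\xi+\overline\xi\in C^{p-1|q-1}$. Extend $\Psi$ additively to $C^n_{\mathrm{LieBi}}\to C^n_{\mathrm{MPL}}$ for all $n\ge0$. **Claim.** $(\mathfrak g,\mathfrak g^*,\mathrm{ad}^*_{\mathfrak g},\mathrm{ad}^*_{\mathfrak g^*})$ is a matched pair of Lie algebras, $(C^\bullet_{\mathrm{LieBi}},\delta_{\mathrm{LieBi}})$ and $(C^\bullet_{\mathrm{MPL}},\delta_{\mathrm{MPL}})$ are cochain complexes, and $\Psi$ is a cochain map: $\delta_{\mathrm{MPL}}\circ\Psi=\Psi\circ\delta_{\mathrm{LieBi}}$. Hence there are unique linear maps $H^n_{\mathrm{LieBi}}(\mathfrak g,\mathfrak g^*)\to H^n_{\mathrm{MPL}}(\mathfrak g,\mathfrak g^*,\mathrm{ad}^*_{\mathfrak g},\mathrm{ad}^*_{\mathfrak g^*})$, $n\ge0$, that send the class of each cocycle $\xi$ to the class of $\Psi(\xi)$. -/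

import Mathlib

open scoped TensorProduct
open CategoryTheory

universe u v w

namespace LieMP

noncomputable section

/-! ## Alternating maps -/

section Alternating

variable {k : Type*} [Field k]
variable {V : Type*} [AddCommGroup V] [Module k V]
variable {W : Type*} [AddCommGroup W] [Module k W]

/-- The alternating map attached to a bilinear map `b` with `b v v = 0`. -/
def alt₂ (b : V →ₗ[k] V →ₗ[k] W) (hb : ∀ v, b v v = 0) : V [⋀^Fin 2]→ₗ[k] W where
  toFun v := b (v 0) (v 1)
  map_update_add' := by
    intro hd v i x y
    obtain rfl : hd = instDecidableEqFin 2 := Subsingleton.elim _ _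
    fin_cases i <;> simp
  map_update_smul' := by
    intro hd v i c x
    obtain rfl : hd = instDecidableEqFin 2 := Subsingleton.elim _ _
    fin_cases i <;> simp
  map_eq_zero_of_eq' v i j h hij := by
    fin_cases i <;> fin_cases j <;> simp_all

@[simp] theorem alt₂_apply (b : V →ₗ[k] V →ₗ[k] W) (hb : ∀ v, b v v = 0) (v : Fin 2 → V) :
    alt₂ b hb v = b (v 0) (v 1) := rfl

/-- The derivation action of an endomorphism on alternating maps:
`(v₁, …, vₙ) ↦ ∑ i, f (v₁, …, A vᵢ, …, vₙ)`. -/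
def derivAlt {n : ℕ} (A : V →ₗ[k] V) (f : V [⋀^Fin n]→ₗ[k] W) : V [⋀^Fin n]→ₗ[k] W where
  toFun v := ∑ i, f (Function.update v i (A (v i)))
  map_update_add' := by
    intro hd v i x y
    obtain rfl : hd = instDecidableEqFin n := Subsingleton.elim _ _
    rw [← Finset.sum_add_distrib]
    refine Finset.sum_congr rfl fun j _ => ?_
    by_cases h : j = i
    · subst h; simp
    · have h' : i ≠ j := fun e => h e.symm
      simp [Function.update_comm h', Function.update_of_ne h]
  map_update_smul' := by
    intro hd v i c x
    obtain rfl : hd = instDecidableEqFin n := Subsingleton.elim _ _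
    rw [Finset.smul_sum]
    refine Finset.sum_congr rfl fun j _ => ?_
    by_cases h : j = i
    · subst h; simp
    · have h' : i ≠ j := fun e => h e.symm
      simp [Function.update_comm h', Function.update_of_ne h]
  map_eq_zero_of_eq' := by
    intro v i j h hij
    rw [Fintype.sum_eq_add i j hij]
    · have e : Function.update v j (A (v j)) =
          Function.update v i (A (v i)) ∘ Equiv.swap i j := by
        ext l
        by_cases hi : l = i
        · subst hi; simp [hij, hij.symm, h]
        · by_cases hj : l = j
          · subst hj; simp [h]
          · simp [Equiv.swap_apply_of_ne_of_ne hi hj, hi, hj]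
      rw [e, f.map_swap _ hij, add_neg_cancel]
    · rintro l ⟨hi, hj⟩
      exact f.map_eq_zero_of_eq _ (by simp [hi.symm, hj.symm, h]) hij

theorem derivAlt_apply {n : ℕ} (A : V →ₗ[k] V) (f : V [⋀^Fin n]→ₗ[k] W) (v : Fin n → V) :
    derivAlt A f v = ∑ i, f (Function.update v i (A (v i))) := rfl

/-- The derivation extension of endomorphisms of `V` to `⋀ⁿ V`:
`A • (v₁ ∧ … ∧ vₙ) = ∑ i, v₁ ∧ … ∧ A vᵢ ∧ … ∧ vₙ`. -/
def extDer (n : ℕ) : (V →ₗ[k] V) →ₗ[k] (⋀[k]^n V →ₗ[k] ⋀[k]^n V) where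
  toFun A := exteriorPower.alternatingMapLinearEquiv (derivAlt A (exteriorPower.ιMulti k n))
  map_add' A B := by
    rw [← map_add]
    congr 1
    ext1 v
    simp only [derivAlt_apply, AlternatingMap.add_apply, LinearMap.add_apply,
      AlternatingMap.map_update_add, Finset.sum_add_distrib]
  map_smul' c A := by
    rw [← map_smul]
    congr 1
    ext1 v
    simp only [derivAlt_apply, AlternatingMap.smul_apply, LinearMap.smul_apply,
      AlternatingMap.map_update_smul, Finset.smul_sum, RingHom.id_apply]

/-- `⋀ⁿ V × V → ⋀ⁿ⁺¹ V`, `(X, x) ↦ X ∧ x`. -/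
def wedgeRight (n : ℕ) : ⋀[k]^n V →ₗ[k] V →ₗ[k] ⋀[k]^(n + 1) V :=
  LinearMap.mk₂ k
    (fun X x => ⟨X.1 * ExteriorAlgebra.ι k x, by
      change X.1 * ExteriorAlgebra.ι k x ∈ LinearMap.range (ExteriorAlgebra.ι k) ^ (n + 1)
      rw [pow_succ]
      exact Submodule.mul_mem_mul X.2 ⟨x, rfl⟩⟩)
    (fun X Y x => Subtype.ext (by simp [add_mul]))
    (fun c X x => Subtype.ext (by simp))
    (fun X x y => Subtype.ext (by simp [mul_add]))
    (fun c X x => Subtype.ext (by simp))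

end Alternating

/-! ## The Chevalley–Eilenberg coboundary -/

section ChevalleyEilenberg

variable {k : Type*} [Field k] [CharZero k]
variable {L : Type*} [LieRing L] [LieAlgebra k L]
variable {W : Type*} [AddCommGroup W] [Module k W]

/-- The bracket of `L` as a bilinear map. -/
def lieBr (k : Type*) [Field k] (L : Type*) [LieRing L] [LieAlgebra k L] :
    L →ₗ[k] L →ₗ[k] L := (LieModule.toEnd k L L : L →ₗ[k] Module.End k L)

@[simp] theorem lieBr_apply {k : Type*} [Field k] {L : Type*} [LieRing L] [LieAlgebra k L]
    (x y : L) : lieBr k L x y = ⁅x, y⁆ := rfl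

/-- The right-hand side of the Chevalley–Eilenberg formula for a cochain `f` in `m + 1` arguments;
the pair `i ≤ j` in the second sum stands for the positions `i.castSucc < j.succ` in
`{0, …, m + 1}`. -/
def ceFun {m : ℕ} (ρ : L →ₗ[k] W →ₗ[k] W) (f : L [⋀^Fin (m + 1)]→ₗ[k] W)
    (x : Fin (m + 2) → L) : W :=
  ∑ i : Fin (m + 2), (-1 : ℤ) ^ (i : ℕ) • ρ (x i) (f (i.removeNth x)) +
  ∑ i : Fin (m + 1), ∑ j ≥ i, (-1 : ℤ) ^ ((i.castSucc : ℕ) + (j.succ : ℕ)) •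
    f (Fin.cons ⁅x i.castSucc, x j.succ⁆ (j.removeNth (i.castSucc.removeNth x)))

/-- `x ↦ ρ_x ∘ f`. -/
def actComp {n : ℕ} (ρ : L →ₗ[k] W →ₗ[k] W) (f : L [⋀^Fin n]→ₗ[k] W) :
    L →ₗ[k] L [⋀^Fin n]→ₗ[k] W where
  toFun x := (ρ x).compAlternatingMap f
  map_add' x y := by ext; simp
  map_smul' c x := by ext; simp

/-- An alternating map with the values `ceFun ρ f`. -/
def ceAux {m : ℕ} (ρ : L →ₗ[k] W →ₗ[k] W) (f : L [⋀^Fin (m + 1)]→ₗ[k] W) :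
    L [⋀^Fin (m + 2)]→ₗ[k] W :=
  AlternatingMap.alternatizeUncurryFin (actComp ρ f) -
  (2⁻¹ : k) • AlternatingMap.alternatizeUncurryFin
    (AlternatingMap.alternatizeUncurryFinLM ∘ₗ
      (LinearMap.llcomp k L L _ f.curryLeft).comp (lieBr k L))

theorem ceAux_apply {m : ℕ} (ρ : L →ₗ[k] W →ₗ[k] W) (f : L [⋀^Fin (m + 1)]→ₗ[k] W)
    (x : Fin (m + 2) → L) : ceAux ρ f x = ceFun ρ f x := by
  rw [ceAux, AlternatingMap.sub_apply, AlternatingMap.smul_apply,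
    AlternatingMap.alternatizeUncurryFin_apply,
    AlternatingMap.alternatizeUncurryFin_alternatizeUncurryFinLM_comp_apply, ceFun,
    sub_eq_add_neg]
  congr 1
  rw [Finset.smul_sum, ← Finset.sum_neg_distrib]
  refine Finset.sum_congr rfl fun i _ => ?_
  rw [Finset.smul_sum, ← Finset.sum_neg_distrib]
  refine Finset.sum_congr rfl fun j _ => ?_
  have key : ∀ (a b : L) (y : Fin m → L),
      f (Fin.cons ⁅a, b⁆ y) - f (Fin.cons ⁅b, a⁆ y) = (2 : k) • f (Fin.cons ⁅a, b⁆ y) := by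
    intro a b y
    have h : f (Fin.cons ⁅b, a⁆ y) = - f (Fin.cons ⁅a, b⁆ y) := by
      have := f.curryLeft.map_neg ⁅a, b⁆
      rw [lie_skew] at this
      exact congrArg (fun F => F y) this
    rw [h, sub_neg_eq_add, two_smul]
  have := key (x i.castSucc) (x j.succ) (j.removeNth (i.castSucc.removeNth x))
  simp only [LinearMap.comp_apply, LinearMap.llcomp_apply, lieBr_apply,
    AlternatingMap.curryLeft_apply_apply, Matrix.vecCons]
  rw [this, smul_comm (2⁻¹ : k), smul_smul, inv_mul_cancel₀ two_ne_zero, one_smul, ← neg_smul]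
  congr 1
  simp only [Fin.val_castSucc, Fin.val_succ]
  ring

/-- The Chevalley–Eilenberg coboundary `Hom(⋀ᵐ⁺¹ L, W) → Hom(⋀ᵐ⁺² L, W)` with coefficients in the
representation `ρ`. -/
def ceD {m : ℕ} (ρ : L →ₗ[k] W →ₗ[k] W) :
    (L [⋀^Fin (m + 1)]→ₗ[k] W) →ₗ[k] L [⋀^Fin (m + 2)]→ₗ[k] W where
  toFun f :=
    { toFun := ceFun ρ f
      map_update_add' := by
        intro _ x i a b
        simp only [← ceAux_apply, AlternatingMap.map_update_add]
      map_update_smul' := by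
        intro _ x i c a
        simp only [← ceAux_apply, AlternatingMap.map_update_smul]
      map_eq_zero_of_eq' := by
        intro x i j h hij
        simp only [← ceAux_apply]
        exact (ceAux ρ f).map_eq_zero_of_eq x h hij }
  map_add' f₁ f₂ := by
    ext x
    change ceFun ρ (f₁ + f₂) x = ceFun ρ f₁ x + ceFun ρ f₂ x
    simp only [ceFun, AlternatingMap.add_apply, map_add, smul_add, Finset.sum_add_distrib]
    abel
  map_smul' c f := by
    ext x
    change ceFun ρ (c • f) x = c • ceFun ρ f x
    simp only [ceFun, AlternatingMap.smul_apply, map_smul, smul_add, Finset.smul_sum]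
    congr 1
    · exact Finset.sum_congr rfl fun i _ => smul_comm _ _ _
    · exact Finset.sum_congr rfl fun i _ => Finset.sum_congr rfl fun j _ => smul_comm _ _ _

@[simp] theorem ceD_apply {m : ℕ} (ρ : L →ₗ[k] W →ₗ[k] W) (f : L [⋀^Fin (m + 1)]→ₗ[k] W)
    (x : Fin (m + 2) → L) : ceD ρ f x = ceFun ρ f x := rfl

/-- The Chevalley–Eilenberg coboundary on linear maps out of the exterior powers. -/
def ceHom (m : ℕ) (ρ : L →ₗ[k] W →ₗ[k] W) :
    (⋀[k]^(m + 1) L →ₗ[k] W) →ₗ[k] (⋀[k]^(m + 2) L →ₗ[k] W) :=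
  exteriorPower.alternatingMapLinearEquiv.toLinearMap ∘ₗ ceD ρ ∘ₗ
    exteriorPower.alternatingMapLinearEquiv.symm.toLinearMap

end ChevalleyEilenberg

/-! ## The Nijenhuis–Richardson bracket -/

section NijenhuisRichardson

variable {k : Type*} [Field k]
variable {V : Type*} [AddCommGroup V] [Module k V]

/-- For `a`-linear `P` and `b`-linear `Q`, the sum over `(a, b)`-shuffles (realised in
`AlternatingMap.domCoprod` as classes of permutations modulo permutations of the two blocks)
`∑ σ, sign σ • P (u_σ(1), …, u_σ(a)) ⊗ Q (u_σ(a+1), …, u_σ(a+b))`,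
as an alternating map in `n = a + b` arguments. -/
def shuffleProd {P Q : Type*} [AddCommGroup P] [Module k P] [AddCommGroup Q] [Module k Q]
    {a b n : ℕ} (e : a + b = n) (p : V [⋀^Fin a]→ₗ[k] P) (q : V [⋀^Fin b]→ₗ[k] Q) :
    V [⋀^Fin n]→ₗ[k] (P ⊗[k] Q) :=
  (p.domCoprod q).domDomCongr (finSumFinEquiv.trans (finCongr e))

/-- `v ⊗ (v₁ ∧ … ∧ vₙ) ↦ g (v, v₁, …, vₙ)`. -/
def evalHead {n : ℕ} (g : V [⋀^Fin (n + 1)]→ₗ[k] V) : V ⊗[k] ⋀[k]^n V →ₗ[k] V :=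
  TensorProduct.lift (exteriorPower.alternatingMapLinearEquiv.toLinearMap ∘ₗ g.curryLeft)

/-- The insertion `i_f g`, for `f` in `m + 1` and `g` in `n + 1` arguments:
`(i_f g)(x₁, …, x_{m+n+1}) =
  ∑ σ ∈ Sh(m+1, n), sign σ • g (f (x_σ(1), …, x_σ(m+1)), x_σ(m+2), …, x_σ(m+n+1))`. -/
def insertion {m n N : ℕ} (e : (m + 1) + n = N) (f : V [⋀^Fin (m + 1)]→ₗ[k] V)
    (g : V [⋀^Fin (n + 1)]→ₗ[k] V) : V [⋀^Fin N]→ₗ[k] V :=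
  (evalHead g).compAlternatingMap (shuffleProd e f (exteriorPower.ιMulti k n))

/-- The Nijenhuis–Richardson bracket `[f, g] = i_f g - (-1)^{mn} i_g f`. -/
def nrBracket {m n N : ℕ} (e : m + n + 1 = N) (f : V [⋀^Fin (m + 1)]→ₗ[k] V)
    (g : V [⋀^Fin (n + 1)]→ₗ[k] V) : V [⋀^Fin N]→ₗ[k] V :=
  insertion (by omega) f g - (-1 : ℤ) ^ (m * n) • insertion (by omega) g f

theorem domCoprod_add_left {P Q : Type*} [AddCommGroup P] [Module k P] [AddCommGroup Q]
    [Module k Q] {a b : ℕ} (p p' : V [⋀^Fin a]→ₗ[k] P) (q : V [⋀^Fin b]→ₗ[k] Q) :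
    (p + p').domCoprod q = p.domCoprod q + p'.domCoprod q := by
  rw [← AlternatingMap.domCoprod'_apply, TensorProduct.add_tmul, map_add]; rfl

theorem domCoprod_smul_left {P Q : Type*} [AddCommGroup P] [Module k P] [AddCommGroup Q]
    [Module k Q] {a b : ℕ} (c : k) (p : V [⋀^Fin a]→ₗ[k] P) (q : V [⋀^Fin b]→ₗ[k] Q) :
    (c • p).domCoprod q = c • p.domCoprod q := by
  rw [← AlternatingMap.domCoprod'_apply, ← TensorProduct.smul_tmul', map_smul]; rfl

theorem evalHead_add {n : ℕ} (g g' : V [⋀^Fin (n + 1)]→ₗ[k] V) :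
    evalHead (g + g') = evalHead g + evalHead g' := by
  apply TensorProduct.ext'; intro x y; simp [evalHead]

theorem evalHead_smul {n : ℕ} (c : k) (g : V [⋀^Fin (n + 1)]→ₗ[k] V) :
    evalHead (c • g) = c • evalHead g := by
  apply TensorProduct.ext'; intro x y; simp [evalHead]

theorem nrBracket_add_right {m n N : ℕ} (e : m + n + 1 = N) (f : V [⋀^Fin (m + 1)]→ₗ[k] V)
    (g g' : V [⋀^Fin (n + 1)]→ₗ[k] V) :
    nrBracket e f (g + g') = nrBracket e f g + nrBracket e f g' := by
  ext x
  simp only [nrBracket, insertion, shuffleProd, evalHead_add, domCoprod_add_left,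
    LinearMap.compAlternatingMap_apply, AlternatingMap.domDomCongr_apply, LinearMap.add_apply,
    AlternatingMap.add_apply, AlternatingMap.sub_apply, AlternatingMap.smul_apply, map_add,
    smul_add]
  abel

theorem nrBracket_smul_right {m n N : ℕ} (e : m + n + 1 = N) (f : V [⋀^Fin (m + 1)]→ₗ[k] V)
    (c : k) (g : V [⋀^Fin (n + 1)]→ₗ[k] V) :
    nrBracket e f (c • g) = c • nrBracket e f g := by
  ext x
  simp only [nrBracket, insertion, shuffleProd, evalHead_smul, domCoprod_smul_left,
    LinearMap.compAlternatingMap_apply, AlternatingMap.domDomCongr_apply, LinearMap.smul_apply,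
    AlternatingMap.sub_apply, AlternatingMap.smul_apply, map_smul, smul_sub]
  rw [smul_comm c]

end NijenhuisRichardson

/-! ## Matched pairs of Lie algebras and their cochain complex -/

section MatchedPair

variable {k : Type*} [Field k]
variable {g : Type*} [LieRing g] [LieAlgebra k g]
variable {h : Type*} [LieRing h] [LieAlgebra k h]

/-- `(g, h, ρ, ψ)` is a matched pair of Lie algebras. -/
structure IsMatchedPair (ρ : g →ₗ[k] h →ₗ[k] h) (ψ : h →ₗ[k] g →ₗ[k] g) : Prop where
  rep_left : ∀ (x y : g) (a : h), ρ ⁅x, y⁆ a = ρ x (ρ y a) - ρ y (ρ x a)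
  rep_right : ∀ (a b : h) (x : g), ψ ⁅a, b⁆ x = ψ a (ψ b x) - ψ b (ψ a x)
  compat_left : ∀ (x : g) (a b : h),
    ρ x ⁅a, b⁆ = ⁅ρ x a, b⁆ + ⁅a, ρ x b⁆ + ρ (ψ b x) a - ρ (ψ a x) b
  compat_right : ∀ (a : h) (x y : g),
    ψ a ⁅x, y⁆ = ⁅ψ a x, y⁆ + ⁅x, ψ a y⁆ + ψ (ρ y a) x - ψ (ρ x a) y

/-- `(μ ⋉ ρ)((x, a), (y, b)) = ([x, y], ρ_x b - ρ_y a)`. -/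
def muRho (ρ : g →ₗ[k] h →ₗ[k] h) : (g × h) [⋀^Fin 2]→ₗ[k] (g × h) :=
  alt₂ (LinearMap.mk₂ k (fun u v => (⁅u.1, v.1⁆, ρ u.1 v.2 - ρ v.1 u.2))
    (fun u u' v => by ext <;> simp; abel) (fun c u v => by ext <;> simp [smul_sub])
    (fun u v v' => by ext <;> simp; abel) (fun c u v => by ext <;> simp [smul_sub]))
    (fun v => by ext <;> simp)

/-- `(ψ ⋊ ν)((x, a), (y, b)) = (ψ_a y - ψ_b x, [a, b])`. -/
def psiNu (ψ : h →ₗ[k] g →ₗ[k] g) : (g × h) [⋀^Fin 2]→ₗ[k] (g × h) :=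
  alt₂ (LinearMap.mk₂ k (fun u v => (ψ u.2 v.1 - ψ v.2 u.1, ⁅u.2, v.2⁆))
    (fun u u' v => by ext <;> simp; abel) (fun c u v => by ext <;> simp [smul_sub])
    (fun u v v' => by ext <;> simp; abel) (fun c u v => by ext <;> simp [smul_sub]))
    (fun v => by ext <;> simp)

/-- `π = μ ⋉ ρ + ψ ⋊ ν`, the bracket of the bicrossed product. -/
def mpPi (ρ : g →ₗ[k] h →ₗ[k] h) (ψ : h →ₗ[k] g →ₗ[k] g) :
    (g × h) [⋀^Fin 2]→ₗ[k] (g × h) := muRho ρ + psiNu ψ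

/-- A tuple in `g ⊕ h` is pure of type `s` if its entries with index in `s` lie in `g` and the
others lie in `h`. -/
def IsPure {n : ℕ} (s : Finset (Fin n)) (u : Fin n → g × h) : Prop :=
  ∀ i, (i ∈ s → (u i).2 = 0) ∧ (i ∉ s → (u i).1 = 0)

variable (k g h) in
/-- The space `C^{p|q}` of alternating maps `f` on `g ⊕ h` in `n = p + q + 1` arguments (`p, q ≥ 0`)
of bidegree `p|q`: on tuples with `p + 1` entries in `g` and `q` entries in `h` the values of `f`
lie in `g`, on tuples with `p` entries in `g` and `q + 1` entries in `h` they lie in `h`,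
and `f` vanishes on all other pure tuples. -/
def bidegree (n p q : ℕ) : Submodule k ((g × h) [⋀^Fin n]→ₗ[k] (g × h)) where
  carrier := {f | ∀ (s : Finset (Fin n)) (u : Fin n → g × h), IsPure s u →
    (¬ (s.card = p + 1 ∧ sᶜ.card = q) → (f u).1 = 0) ∧
    (¬ (s.card = p ∧ sᶜ.card = q + 1) → (f u).2 = 0)}
  add_mem' hf hf' s u hu :=
    ⟨fun hs => by simp [(hf s u hu).1 hs, (hf' s u hu).1 hs],
      fun hs => by simp [(hf s u hu).2 hs, (hf' s u hu).2 hs]⟩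
  zero_mem' s u hu := by simp
  smul_mem' c f hf s u hu :=
    ⟨fun hs => by simp [(hf s u hu).1 hs], fun hs => by simp [(hf s u hu).2 hs]⟩

variable (k g h) in
/-- `M^{n-1} = C^{n-1|0} ⊕ C^{n-2|1} ⊕ … ⊕ C^{0|n-1}`, a space of alternating maps in `n`
arguments (`n ≥ 1`). -/
def mSpace (n : ℕ) : Submodule k ((g × h) [⋀^Fin n]→ₗ[k] (g × h)) :=
  ⨆ i : {i : ℕ × ℕ // i.1 + i.2 + 1 = n}, bidegree k g h n i.1.1 i.1.2

/-- The coboundary on all alternating maps on `g ⊕ h`: it is `F ↦ -[π, F]`, and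
`u ↦ (v ↦ -[u, v])` on constants. -/
def mpDelta (ρ : g →ₗ[k] h →ₗ[k] h) (ψ : h →ₗ[k] g →ₗ[k] g) : (n : ℕ) →
    ((g × h) [⋀^Fin n]→ₗ[k] (g × h)) →ₗ[k] ((g × h) [⋀^Fin (n + 1)]→ₗ[k] (g × h))
  | 0 =>
    { toFun := fun u => -(mpPi ρ ψ).curryLeft (u ![])
      map_add' := fun u u' => by simp only [AlternatingMap.add_apply, map_add, neg_add]
      map_smul' := fun c u => by
        simp only [AlternatingMap.smul_apply, map_smul, smul_neg, RingHom.id_apply] }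
  | n + 1 =>
    { toFun := fun F => -nrBracket (m := 1) (by omega) (mpPi ρ ψ) F
      map_add' := fun F F' => by rw [nrBracket_add_right, neg_add]
      map_smul' := fun c F => by rw [nrBracket_smul_right, smul_neg, RingHom.id_apply] }

/-- The cochain spaces of `(g, h, ρ, ψ)`: `M^{n-1}` for `n ≥ 1`, and for `n = 0` the elements of
`g ⊕ h` (as alternating maps in no arguments) whose coboundary lies in `M^0 = C^{0|0}`. -/
def mpCochain (ρ : g →ₗ[k] h →ₗ[k] h) (ψ : h →ₗ[k] g →ₗ[k] g) : (n : ℕ) →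
    Submodule k ((g × h) [⋀^Fin n]→ₗ[k] (g × h))
  | 0 => (mSpace k g h 1).comap (mpDelta ρ ψ 0)
  | n + 1 => mSpace k g h (n + 1)

theorem card_split {a b n : ℕ} (σ : Fin a ⊕ Fin b ≃ Fin n) (s : Finset (Fin n)) :
    s.card = (Finset.univ.filter fun i => σ (Sum.inl i) ∈ s).card +
      (Finset.univ.filter fun i => σ (Sum.inr i) ∈ s).card := by
  classical
  have h1 : s.card = ∑ i : Fin n, if i ∈ s then 1 else 0 := by simp
  rw [h1, ← Equiv.sum_comp σ, Fintype.sum_sum_type]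
  simp only [Finset.card_filter]

theorem shuffleProd_induction {V : Type*} [AddCommGroup V] [Module k V] {P Q R : Type*}
    [AddCommGroup P] [Module k P] [AddCommGroup Q] [Module k Q] [AddCommGroup R] [Module k R]
    {a b n : ℕ} (e : a + b = n) (p : V [⋀^Fin a]→ₗ[k] P) (q : V [⋀^Fin b]→ₗ[k] Q)
    (T : P ⊗[k] Q →ₗ[k] R) (u : Fin n → V)
    (H : ∀ σ : Fin a ⊕ Fin b ≃ Fin n,
      T (p (fun i => u (σ (Sum.inl i))) ⊗ₜ q (fun i => u (σ (Sum.inr i)))) = 0) :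
    T (shuffleProd e p q u) = 0 := by
  rw [shuffleProd, AlternatingMap.domDomCongr_apply, AlternatingMap.domCoprod_apply,
    _root_.sum_apply, map_sum]
  refine Finset.sum_eq_zero fun σ _ => ?_
  induction σ using Quotient.inductionOn' with | _ σ
  rw [AlternatingMap.domCoprod.summand_mk'', _root_.smul_apply,
    MultilinearMap.domDomCongr_apply, MultilinearMap.domCoprod_apply]
  have := H (σ.trans (finSumFinEquiv.trans (finCongr e)))
  rw [Units.smul_def, map_zsmul]
  exact (congrArg _ this).trans (smul_zero _)

theorem insertion_mem {m n N p q p' q' : ℕ} (e : (m + 1) + n = N)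
    {f : (g × h) [⋀^Fin (m + 1)]→ₗ[k] (g × h)} {f' : (g × h) [⋀^Fin (n + 1)]→ₗ[k] (g × h)}
    (hf : f ∈ bidegree k g h (m + 1) p q) (hf' : f' ∈ bidegree k g h (n + 1) p' q') :
    insertion e f f' ∈ bidegree k g h N (p + p') (q + q') := by
  classical
  intro s u hu
  have main : ∀ (T : g × h →ₗ[k] g × h), (∀ (s₁ : Finset (Fin (m + 1)))
      (s₂ : Finset (Fin n)) (w : Fin (m + 1) → g × h) (v : Fin n → g × h),
      IsPure s₁ w → IsPure s₂ v → s.card = s₁.card + s₂.card →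
      sᶜ.card = s₁ᶜ.card + s₂ᶜ.card → T (f' (Fin.cons (f w) v)) = 0) →
      T (insertion e f f' u) = 0 := by
    intro T hT
    rw [insertion, LinearMap.compAlternatingMap_apply, ← LinearMap.comp_apply]
    refine shuffleProd_induction e _ _ _ u fun σ => ?_
    have : (T ∘ₗ evalHead f') ((f fun i => u (σ (Sum.inl i))) ⊗ₜ
        (exteriorPower.ιMulti k n fun i => u (σ (Sum.inr i)))) =
        T (f' (Fin.cons (f fun i => u (σ (Sum.inl i))) fun i => u (σ (Sum.inr i)))) := by
      simp [evalHead, Matrix.vecCons]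
    rw [this]
    refine hT (Finset.univ.filter fun i => σ (Sum.inl i) ∈ s)
      (Finset.univ.filter fun i => σ (Sum.inr i) ∈ s) _ _ ?_ ?_ (card_split σ s) ?_
    · intro i; simpa using hu (σ (Sum.inl i))
    · intro i; simpa using hu (σ (Sum.inr i))
    · rw [card_split σ sᶜ]; simp [Finset.compl_filter]
  have split : ∀ (w : g × h) (v : Fin n → g × h),
      f' (Fin.cons w v) = f' (Fin.cons (w.1, 0) v) + f' (Fin.cons (0, w.2) v) := by
    intro w v
    have := f'.curryLeft.map_add (w.1, 0) (0, w.2)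
    rw [Prod.mk_add_mk, add_zero, zero_add] at this
    exact congrArg (fun F => F v) this
  have zero : ∀ (v : Fin n → g × h), f' (Fin.cons 0 v) = 0 := by
    intro v
    exact congrArg (fun F => F v) (f'.curryLeft.map_zero)
  have pureL : ∀ (x : g) (s₂ : Finset (Fin n)) (v : Fin n → g × h), IsPure s₂ v →
      IsPure (insert 0 (s₂.map (Fin.succEmb n))) (Fin.cons (x, (0 : h)) v : Fin (n + 1) → g × h) ∧
      (insert 0 (s₂.map (Fin.succEmb n))).card = s₂.card + 1 ∧
      (insert 0 (s₂.map (Fin.succEmb n)))ᶜ.card = s₂ᶜ.card := by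
    intro x s₂ v hv
    have hc : (insert 0 (s₂.map (Fin.succEmb n))).card = s₂.card + 1 := by
      rw [Finset.card_insert_of_notMem (by simp), Finset.card_map]
    refine ⟨fun i => ?_, hc, ?_⟩
    · refine Fin.cases ?_ (fun j => ?_) i
      · simp
      · simpa using hv j
    · rw [Finset.card_compl, Finset.card_compl, hc]; simp
  have pureR : ∀ (a : h) (s₂ : Finset (Fin n)) (v : Fin n → g × h), IsPure s₂ v →
      IsPure (s₂.map (Fin.succEmb n)) (Fin.cons ((0 : g), a) v : Fin (n + 1) → g × h) ∧
      (s₂.map (Fin.succEmb n)).card = s₂.card ∧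
      (s₂.map (Fin.succEmb n))ᶜ.card = s₂ᶜ.card + 1 := by
    intro a s₂ v hv
    have hle : s₂.card ≤ n := by simpa using Finset.card_le_univ s₂
    refine ⟨fun i => ?_, by simp, ?_⟩
    · refine Fin.cases ?_ (fun j => ?_) i
      · simp
      · simpa using hv j
    · rw [Finset.card_compl, Finset.card_compl, Finset.card_map]; simp; omega
  constructor
  · intro hs
    have := main (LinearMap.inl k g h ∘ₗ LinearMap.fst k g h) ?_
    · simpa using congrArg Prod.fst this
    · intro s₁ s₂ w v hw hv h1 h2
      obtain ⟨a1, a2, a3⟩ := pureL (f w).1 s₂ v hv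
      obtain ⟨b1, b2, b3⟩ := pureR (f w).2 s₂ v hv
      have e1 : (f' (Fin.cons ((f w).1, 0) v)).1 = 0 := by
        by_cases c1 : s₁.card = p + 1 ∧ s₁ᶜ.card = q
        · exact (hf' _ _ a1).1 (by omega)
        · rw [(hf s₁ w hw).1 c1]
          exact congrArg Prod.fst (zero v)
      have e2 : (f' (Fin.cons (0, (f w).2) v)).1 = 0 := by
        by_cases c1 : s₁.card = p ∧ s₁ᶜ.card = q + 1
        · exact (hf' _ _ b1).1 (by omega)
        · rw [(hf s₁ w hw).2 c1]
          exact congrArg Prod.fst (zero v)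
      simp [split (f w) v, e1, e2]
  · intro hs
    have := main (LinearMap.inr k g h ∘ₗ LinearMap.snd k g h) ?_
    · simpa using congrArg Prod.snd this
    · intro s₁ s₂ w v hw hv h1 h2
      obtain ⟨a1, a2, a3⟩ := pureL (f w).1 s₂ v hv
      obtain ⟨b1, b2, b3⟩ := pureR (f w).2 s₂ v hv
      have e1 : (f' (Fin.cons ((f w).1, 0) v)).2 = 0 := by
        by_cases c1 : s₁.card = p + 1 ∧ s₁ᶜ.card = q
        · exact (hf' _ _ a1).2 (by omega)
        · rw [(hf s₁ w hw).1 c1]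
          exact congrArg Prod.snd (zero v)
      have e2 : (f' (Fin.cons (0, (f w).2) v)).2 = 0 := by
        by_cases c1 : s₁.card = p ∧ s₁ᶜ.card = q + 1
        · exact (hf' _ _ b1).2 (by omega)
        · rw [(hf s₁ w hw).2 c1]
          exact congrArg Prod.snd (zero v)
      simp [split (f w) v, e1, e2]

theorem nrBracket_mem {m n N p q p' q' : ℕ} (e : m + n + 1 = N)
    {f : (g × h) [⋀^Fin (m + 1)]→ₗ[k] (g × h)} {f' : (g × h) [⋀^Fin (n + 1)]→ₗ[k] (g × h)}
    (hf : f ∈ bidegree k g h (m + 1) p q) (hf' : f' ∈ bidegree k g h (n + 1) p' q') :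
    nrBracket e f f' ∈ bidegree k g h N (p + p') (q + q') := by
  refine Submodule.sub_mem _ (insertion_mem _ hf hf') (zsmul_mem ?_ _)
  rw [add_comm p, add_comm q]
  exact insertion_mem _ hf' hf

theorem pure_two {s : Finset (Fin 2)} {u : Fin 2 → g × h} (hu : IsPure s u) :
    (s.card = 2 ∧ sᶜ.card = 0 ∧ (u 0).2 = 0 ∧ (u 1).2 = 0) ∨
    (s.card = 1 ∧ sᶜ.card = 1 ∧ (u 0).2 = 0 ∧ (u 1).1 = 0) ∨
    (s.card = 1 ∧ sᶜ.card = 1 ∧ (u 0).1 = 0 ∧ (u 1).2 = 0) ∨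
    (s.card = 0 ∧ sᶜ.card = 2 ∧ (u 0).1 = 0 ∧ (u 1).1 = 0) := by
  have h0 := hu 0
  have h1 := hu 1
  have hc : s.card = (if 0 ∈ s then 1 else 0) + (if 1 ∈ s then 1 else 0) := by
    rw [← Fin.sum_univ_two (fun i => if i ∈ s then 1 else 0)]; simp
  have hcc : sᶜ.card = 2 - s.card := by rw [Finset.card_compl]; simp
  by_cases a : 0 ∈ s <;> by_cases b : 1 ∈ s <;> simp_all

theorem muRho_mem (ρ : g →ₗ[k] h →ₗ[k] h) : muRho ρ ∈ bidegree k g h 2 1 0 := by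
  intro s u hu
  rcases pure_two hu with ⟨a, b, c, d⟩ | ⟨a, b, c, d⟩ | ⟨a, b, c, d⟩ | ⟨a, b, c, d⟩ <;>
    simp [muRho, a, b, c, d]

theorem psiNu_mem (ψ : h →ₗ[k] g →ₗ[k] g) : psiNu ψ ∈ bidegree k g h 2 0 1 := by
  intro s u hu
  rcases pure_two hu with ⟨a, b, c, d⟩ | ⟨a, b, c, d⟩ | ⟨a, b, c, d⟩ | ⟨a, b, c, d⟩ <;>
    simp [psiNu, a, b, c, d]

theorem nrBracket_add_left {V : Type*} [AddCommGroup V] [Module k V] {m n N : ℕ}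
    (e : m + n + 1 = N) (f f' : V [⋀^Fin (m + 1)]→ₗ[k] V) (F : V [⋀^Fin (n + 1)]→ₗ[k] V) :
    nrBracket e (f + f') F = nrBracket e f F + nrBracket e f' F := by
  ext x
  simp only [nrBracket, insertion, shuffleProd, evalHead_add, domCoprod_add_left,
    LinearMap.compAlternatingMap_apply, AlternatingMap.domDomCongr_apply, LinearMap.add_apply,
    AlternatingMap.add_apply, AlternatingMap.sub_apply, AlternatingMap.smul_apply, map_add,
    smul_add]
  abel

theorem mpDelta_mem (ρ : g →ₗ[k] h →ₗ[k] h) (ψ : h →ₗ[k] g →ₗ[k] g) (n : ℕ)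
    (F : (g × h) [⋀^Fin n]→ₗ[k] (g × h)) (hF : F ∈ mpCochain ρ ψ n) :
    mpDelta ρ ψ n F ∈ mpCochain ρ ψ (n + 1) := by
  cases n with
  | zero => exact hF
  | succ n =>
    have key : mSpace k g h (n + 1) ≤ (mSpace k g h (n + 2)).comap (mpDelta ρ ψ (n + 1)) := by
      refine iSup_le fun ⟨⟨p, q⟩, hpq⟩ F hF => ?_
      change -nrBracket (m := 1) _ (muRho ρ + psiNu ψ) F ∈ mSpace k g h (n + 2)
      rw [nrBracket_add_left]
      refine neg_mem (add_mem ?_ ?_)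
      · exact Submodule.mem_iSup_of_mem ⟨(1 + p, 0 + q), by simp at hpq ⊢; omega⟩
          (nrBracket_mem _ (muRho_mem ρ) hF)
      · exact Submodule.mem_iSup_of_mem ⟨(0 + p, 1 + q), by simp at hpq ⊢; omega⟩
          (nrBracket_mem _ (psiNu_mem ψ) hF)
    exact key hF

/-- The space of `n`-cochains of `(g, h, ρ, ψ)`, as a type. -/
def MPCochain (ρ : g →ₗ[k] h →ₗ[k] h) (ψ : h →ₗ[k] g →ₗ[k] g) (n : ℕ) : Type _ :=
  mpCochain ρ ψ n

instance (ρ : g →ₗ[k] h →ₗ[k] h) (ψ : h →ₗ[k] g →ₗ[k] g) (n : ℕ) :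
    AddCommGroup (MPCochain ρ ψ n) := inferInstanceAs (AddCommGroup (mpCochain ρ ψ n))

instance (ρ : g →ₗ[k] h →ₗ[k] h) (ψ : h →ₗ[k] g →ₗ[k] g) (n : ℕ) :
    Module k (MPCochain ρ ψ n) := inferInstanceAs (Module k (mpCochain ρ ψ n))

/-- The alternating map underlying a cochain. -/
def MPCochain.val (ρ : g →ₗ[k] h →ₗ[k] h) (ψ : h →ₗ[k] g →ₗ[k] g) (n : ℕ) :
    MPCochain ρ ψ n →ₗ[k] (g × h) [⋀^Fin n]→ₗ[k] (g × h) := (mpCochain ρ ψ n).subtype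

/-- The coboundary of the cochain complex of `(g, h, ρ, ψ)`. -/
def mpD (ρ : g →ₗ[k] h →ₗ[k] h) (ψ : h →ₗ[k] g →ₗ[k] g) (n : ℕ) :
    MPCochain ρ ψ n →ₗ[k] MPCochain ρ ψ (n + 1) :=
  LinearMap.codRestrict (mpCochain ρ ψ (n + 1)) (mpDelta ρ ψ n ∘ₗ MPCochain.val ρ ψ n)
    (fun F => mpDelta_mem ρ ψ n F.1 F.2)

theorem mpD_val (ρ : g →ₗ[k] h →ₗ[k] h) (ψ : h →ₗ[k] g →ₗ[k] g) (n : ℕ)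
    (F : MPCochain ρ ψ n) :
    MPCochain.val ρ ψ (n + 1) (mpD ρ ψ n F) = mpDelta ρ ψ n (MPCochain.val ρ ψ n F) := rfl

variable (k) in
/-- The extension to `g ⊕ h` of a map `θ : ⋀ᵃ g ⊗ ⋀ᵇ h → W`, through the inclusion of
`⋀ᵃ g ⊗ ⋀ᵇ h` as a direct summand of `⋀ⁿ(g ⊕ h)`, `n = a + b`, by `X ⊗ Y ↦ X ∧ Y`: it equals
`θ (x₁ ∧ … ∧ xₐ, y₁ ∧ … ∧ y_b)` on `(x₁, …, xₐ, y₁, …, y_b)`, `xᵢ ∈ g`, `yⱼ ∈ h`, and vanishes on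
the other summands. -/
def extendSum {W : Type*} [AddCommGroup W] [Module k W] {a b n : ℕ} (e : a + b = n) :
    (⋀[k]^a g →ₗ[k] ⋀[k]^b h →ₗ[k] W) →ₗ[k] (g × h) [⋀^Fin n]→ₗ[k] W where
  toFun θ := (TensorProduct.lift θ).compAlternatingMap (shuffleProd e
    ((exteriorPower.ιMulti k a).compLinearMap (LinearMap.fst k g h))
    ((exteriorPower.ιMulti k b).compLinearMap (LinearMap.snd k g h)))
  map_add' θ θ' := by
    ext x
    have : TensorProduct.lift (θ + θ') = TensorProduct.lift θ + TensorProduct.lift θ' := by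
      apply TensorProduct.ext'; intro x y; simp
    simp [this]
  map_smul' c θ := by
    ext x
    have : TensorProduct.lift (c • θ) = c • TensorProduct.lift θ := by
      apply TensorProduct.ext'; intro x y; simp
    simp [this]

theorem extendSum_eq_zero {W : Type*} [AddCommGroup W] [Module k W] {a b n : ℕ} (e : a + b = n)
    (θ : ⋀[k]^a g →ₗ[k] ⋀[k]^b h →ₗ[k] W) {s : Finset (Fin n)} {u : Fin n → g × h}
    (hu : IsPure s u) (hs : ¬ (s.card = a ∧ sᶜ.card = b)) : extendSum k e θ u = 0 := by
  classical
  refine shuffleProd_induction e _ _ (TensorProduct.lift θ) u fun σ => ?_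
  by_cases h1 : ∀ i, σ (Sum.inl i) ∈ s
  · by_cases h2 : ∀ i, σ (Sum.inr i) ∉ s
    · exfalso
      apply hs
      rw [card_split σ s, card_split σ sᶜ]
      simp [h1, h2]
    · push Not at h2
      obtain ⟨i, hi⟩ := h2
      have : ((exteriorPower.ιMulti k b).compLinearMap (LinearMap.snd k g h))
          (fun i => u (σ (Sum.inr i))) = 0 := by
        rw [AlternatingMap.compLinearMap_apply]
        exact AlternatingMap.map_coord_zero _ i ((hu _).1 hi)
      simp [this]
  · push Not at h1
    obtain ⟨i, hi⟩ := h1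
    have : ((exteriorPower.ιMulti k a).compLinearMap (LinearMap.fst k g h))
        (fun i => u (σ (Sum.inl i))) = 0 := by
      rw [AlternatingMap.compLinearMap_apply]
      exact AlternatingMap.map_coord_zero _ i ((hu _).2 hi)
    simp [this]

end MatchedPair

/-! ## Duality for exterior powers -/

section Duality

variable {k : Type*} [Field k]
variable {V : Type*} [AddCommGroup V] [Module k V] [FiniteDimensional k V]

theorem pairingDual_bijective (n : ℕ) :
    Function.Bijective (exteriorPower.pairingDual k V n) := by
  let b := Module.finBasis k V
  have hsurj : Function.Surjective (exteriorPower.pairingDual k V n) := by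
    rw [← LinearMap.range_eq_top, eq_top_iff, ← (b.exteriorPower n).dualBasis.span_eq,
      Submodule.span_le]
    rintro _ ⟨s, rfl⟩
    refine ⟨exteriorPower.ιMulti_family k n b.coord s, ?_⟩
    rw [Module.Basis.coe_dualBasis, exteriorPower.basis_coord]
    rfl
  refine ⟨?_, hsurj⟩
  rwa [LinearMap.injective_iff_surjective_of_finrank_eq_finrank]
  rw [Subspace.dual_finrank_eq, exteriorPower.finrank_eq, exteriorPower.finrank_eq,
    Subspace.dual_finrank_eq]

variable (k V) in
/-- `⋀ⁿ V* ≃ (⋀ⁿ V)*`, for the pairing `⟨α₁ ∧ … ∧ αₙ, v₁ ∧ … ∧ vₙ⟩ = det (αⱼ(vᵢ))`. -/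
def powDual (n : ℕ) : ⋀[k]^n (Module.Dual k V) ≃ₗ[k] Module.Dual k (⋀[k]^n V) :=
  LinearEquiv.ofBijective (exteriorPower.pairingDual k V n) (pairingDual_bijective n)

@[simp] theorem powDual_ιMulti (n : ℕ) (α : Fin n → Module.Dual k V) (v : Fin n → V) :
    powDual k V n (exteriorPower.ιMulti k n α) (exteriorPower.ιMulti k n v) =
      Matrix.det (Matrix.of fun i j => α j (v i)) :=
  exteriorPower.pairingDual_ιMulti_ιMulti α v

/-- Transposition of linear maps between finite-dimensional spaces. -/
def transposeEquiv (M N : Type*) [AddCommGroup M] [Module k M] [FiniteDimensional k M]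
    [AddCommGroup N] [Module k N] [FiniteDimensional k N] :
    (M →ₗ[k] N) ≃ₗ[k] (Module.Dual k N →ₗ[k] Module.Dual k M) :=
  LinearEquiv.ofBijective Module.Dual.transpose (by
    have hinj : Function.Injective (Module.Dual.transpose (R := k) (M := M) (M' := N)) := by
      intro f f' hf
      ext m
      rw [← sub_eq_zero, ← Module.forall_dual_apply_eq_zero_iff k]
      intro φ
      have := congrArg (fun F => F φ m) hf
      simpa [Module.Dual.transpose_apply, sub_eq_zero] using this
    refine ⟨hinj, fun F => ?_⟩
    refine ⟨(Module.evalEquiv k N).symm.toLinearMap ∘ₗ F.dualMap ∘ₗ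
      (Module.evalEquiv k M).toLinearMap, ?_⟩
    refine LinearMap.ext₂ fun φ m => ?_
    rw [Module.Dual.transpose_apply]
    simp)

end Duality

/-! ## Lie bialgebras -/

section LieBialgebra

/-- The map `g → ⋀² g` dual to a map `⋀² g* → g*`. -/
def cobracketOf {k : Type*} [Field k] {g : Type*} [AddCommGroup g] [Module k g]
    [FiniteDimensional k g] (ν : (Module.Dual k g) [⋀^Fin 2]→ₗ[k] (Module.Dual k g)) :
    g →ₗ[k] ⋀[k]^2 g :=
  (transposeEquiv g (⋀[k]^2 g)).symm
    (exteriorPower.alternatingMapLinearEquiv ν ∘ₗ (powDual k g 2).symm.toLinearMap)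

/-- A Lie bialgebra `(g, g*)` on a finite-dimensional Lie algebra `g`: a Lie bracket on `g*` such
that the dual map `δ : g → ⋀² g` is a `1`-cocycle with values in the adjoint representation. -/
structure LieBialgebra (k : Type u) (g : Type v) [Field k] [LieRing g] [LieAlgebra k g]
    [FiniteDimensional k g] where
  /-- the bracket of `g*` -/
  dualBracket : (Module.Dual k g) [⋀^Fin 2]→ₗ[k] (Module.Dual k g)
  jacobi : ∀ α β γ : Module.Dual k g,
    dualBracket ![dualBracket ![α, β], γ] + dualBracket ![dualBracket ![β, γ], α] +
      dualBracket ![dualBracket ![γ, α], β] = 0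
  cocycle : ∀ x y : g, cobracketOf dualBracket ⁅x, y⁆ =
    extDer 2 (lieBr k g x) (cobracketOf dualBracket y) -
      extDer 2 (lieBr k g y) (cobracketOf dualBracket x)

namespace LieBialgebra

variable {k : Type u} {g : Type v} [Field k] [LieRing g] [LieAlgebra k g]
  [FiniteDimensional k g]

/-- The dual space of `g`, as the carrier of the Lie algebra `g*` of a Lie bialgebra. -/
def DualAlg (_B : LieBialgebra k g) : Type (max u v) := Module.Dual k g

variable (B : LieBialgebra k g)

instance : AddCommGroup B.DualAlg := inferInstanceAs (AddCommGroup (Module.Dual k g))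

instance : Module k B.DualAlg := inferInstanceAs (Module k (Module.Dual k g))

instance : FiniteDimensional k B.DualAlg :=
  inferInstanceAs (FiniteDimensional k (Module.Dual k g))

/-- The identification of `B.DualAlg` with the dual space of `g`. -/
def toDual : B.DualAlg ≃ₗ[k] Module.Dual k g := LinearEquiv.refl k (Module.Dual k g)

theorem dualBracket_swap (α β : Module.Dual k g) :
    B.dualBracket ![α, β] = -B.dualBracket ![β, α] := by
  have h := B.dualBracket.map_swap ![β, α] (i := 0) (j := 1) (by simp)
  rw [← h]
  congr 1
  ext i : 1
  fin_cases i <;> rfl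

instance : LieRing B.DualAlg where
  bracket α β := B.toDual.symm (B.dualBracket ![B.toDual α, B.toDual β])
  add_lie α β γ := by
    change B.dualBracket (Matrix.vecCons (α + β) _) = _
    exact B.dualBracket.map_vecCons_add _ _ _
  lie_add α β γ := by
    change B.dualBracket.curryLeft α (Matrix.vecCons (β + γ) _) = _
    exact AlternatingMap.map_vecCons_add _ _ _ _
  lie_self α := B.dualBracket.map_eq_zero_of_eq _ (i := 0) (j := 1) rfl (by simp)
  leibniz_lie α β γ := by
    have h := B.jacobi (B.toDual α) (B.toDual β) (B.toDual γ)
    rw [B.dualBracket_swap (B.dualBracket ![B.toDual β, B.toDual γ]),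
      B.dualBracket_swap (B.dualBracket ![B.toDual γ, B.toDual α]),
      B.dualBracket_swap (B.toDual γ) (B.toDual α)] at h
    have h2 : B.dualBracket ![B.toDual β, -B.dualBracket ![B.toDual α, B.toDual γ]] =
        -B.dualBracket ![B.toDual β, B.dualBracket ![B.toDual α, B.toDual γ]] := by
      rw [B.dualBracket_swap, B.dualBracket_swap (B.toDual β), neg_inj]
      exact congrArg (fun F : (Module.Dual k g) [⋀^Fin 1]→ₗ[k] (Module.Dual k g) =>
        F ![B.toDual β]) (map_neg B.dualBracket.curryLeft _)
    rw [h2, neg_neg] at h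
    change B.dualBracket ![B.toDual α, B.dualBracket ![B.toDual β, B.toDual γ]] =
      B.dualBracket ![B.dualBracket ![B.toDual α, B.toDual β], B.toDual γ] +
      B.dualBracket ![B.toDual β, B.dualBracket ![B.toDual α, B.toDual γ]]
    rw [← sub_eq_zero, ← neg_eq_zero, ← h]
    abel

instance : LieAlgebra k B.DualAlg where
  lie_smul c α β := by
    change B.dualBracket.curryLeft α (Matrix.vecCons (c • β) _) = _
    exact AlternatingMap.map_vecCons_smul _ _ _ _

theorem toDual_lie (α β : B.DualAlg) :
    B.toDual ⁅α, β⁆ = B.dualBracket ![B.toDual α, B.toDual β] := rfl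

/-- The coadjoint action of `g` on `g*`: `(ad*_x α)(y) = -α([x, y])`. -/
def coadLeft : g →ₗ[k] B.DualAlg →ₗ[k] B.DualAlg :=
  LinearMap.mk₂ k (fun x α => B.toDual.symm (-(B.toDual α ∘ₗ lieBr k g x)))
    (fun x x' α => by rw [← map_add]; congr 1; ext y; simp; abel)
    (fun c x α => by rw [← map_smul]; congr 1; ext y; simp)
    (fun x α α' => by rw [← map_add]; congr 1; ext y; simp; abel)
    (fun c x α => by rw [← map_smul]; congr 1; ext y; simp)

theorem coadLeft_apply (x : g) (α : B.DualAlg) (y : g) :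
    B.toDual (B.coadLeft x α) y = -B.toDual α ⁅x, y⁆ := rfl

/-- The coadjoint action of `g*` on `g = g**`: `β (ad*_α x) = -[α, β](x)`. -/
def coadRight : B.DualAlg →ₗ[k] g →ₗ[k] g :=
  LinearMap.mk₂ k (fun α x => (Module.evalEquiv k g).symm
      (-(Module.Dual.eval k g x ∘ₗ B.toDual.toLinearMap ∘ₗ lieBr k B.DualAlg α ∘ₗ
        B.toDual.symm.toLinearMap)))
    (fun x x' α => by rw [← map_add]; congr 1; ext y; simp; abel)
    (fun c x α => by rw [← map_smul]; congr 1; ext y; simp)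
    (fun x α α' => by rw [← map_add]; congr 1; ext y; simp; abel)
    (fun c x α => by rw [← map_smul]; congr 1; ext y; simp)

theorem coadRight_apply (α β : B.DualAlg) (x : g) :
    B.toDual β (B.coadRight α x) = -B.toDual ⁅α, β⁆ x := by
  rw [coadRight, LinearMap.mk₂_apply, Module.apply_evalEquiv_symm_apply]
  rfl

/-! ### The complex of a Lie bialgebra -/

/-- The pairing `⋀ⁿ g* ≃ (⋀ⁿ g)*`, `⟨α₁ ∧ … ∧ αₙ, x₁ ∧ … ∧ xₙ⟩ = det (αⱼ(xᵢ))`. -/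
def pairing (n : ℕ) : ⋀[k]^n B.DualAlg ≃ₗ[k] Module.Dual k (⋀[k]^n g) :=
  powDual k g n

theorem pairing_ιMulti (n : ℕ) (α : Fin n → B.DualAlg) (x : Fin n → g) :
    B.pairing n (exteriorPower.ιMulti k n α) (exteriorPower.ιMulti k n x) =
      Matrix.det (Matrix.of fun i j => B.toDual (α j) (x i)) :=
  powDual_ιMulti n α x

/-- The identification `Hom(⋀ᵖ g, ⋀^q g) ≃ Hom(⋀^q g*, ⋀ᵖ g*)`, `ξ ↦ ξ*`, with the sign of the
interchange of `⋀ᵖ` and `⋀^q`: `⟨ξ*(Y), X⟩ = (-1)^{pq} ⟨Y, ξ(X)⟩`. -/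
def transposeHom (p q : ℕ) :
    (⋀[k]^p g →ₗ[k] ⋀[k]^q g) ≃ₗ[k] (⋀[k]^q B.DualAlg →ₗ[k] ⋀[k]^p B.DualAlg) :=
  (transposeEquiv (⋀[k]^p g) (⋀[k]^q g)).trans
    ((LinearEquiv.arrowCongr (B.pairing q).symm (B.pairing p).symm).trans
      (LinearEquiv.smulOfNeZero k (⋀[k]^q B.DualAlg →ₗ[k] ⋀[k]^p B.DualAlg) ((-1) ^ (p * q)) (by simp)))

theorem transposeHom_apply (p q : ℕ) (ξ : ⋀[k]^p g →ₗ[k] ⋀[k]^q g) (Y : ⋀[k]^q B.DualAlg)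
    (X : ⋀[k]^p g) :
    B.pairing p (B.transposeHom p q ξ Y) X = (-1) ^ (p * q) * B.pairing q Y (ξ X) := by
  have : transposeEquiv (⋀[k]^p g) (⋀[k]^q g) ξ (B.pairing q Y) X = B.pairing q Y (ξ X) := rfl
  simp [transposeHom, this]

/-- `δ_g : Hom(⋀ᵖ g, ⋀^q g) → Hom(⋀ᵖ⁺¹ g, ⋀^q g)`, `p = a + 1`: the Chevalley–Eilenberg coboundary
of `g` with coefficients in the adjoint representation on `⋀^q g`. -/
def dLeft [CharZero k] (_B : LieBialgebra k g) (a q : ℕ) :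
    (⋀[k]^(a + 1) g →ₗ[k] ⋀[k]^q g) →ₗ[k] (⋀[k]^(a + 2) g →ₗ[k] ⋀[k]^q g) :=
  ceHom a (extDer q ∘ₗ lieBr k g)

/-- `δ_{g*} : Hom(⋀ᵖ g, ⋀^q g) → Hom(⋀ᵖ g, ⋀^{q+1} g)`, `q = b + 1`: the Chevalley–Eilenberg
coboundary of `g*` with coefficients in the adjoint representation on `⋀ᵖ g*`, transported along
`ξ ↦ ξ*`. -/
def dRight [CharZero k] (p b : ℕ) :
    (⋀[k]^p g →ₗ[k] ⋀[k]^(b + 1) g) →ₗ[k] (⋀[k]^p g →ₗ[k] ⋀[k]^(b + 2) g) :=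
  (B.transposeHom p (b + 2)).symm.toLinearMap ∘ₗ
    ceHom b (extDer p ∘ₗ lieBr k B.DualAlg) ∘ₗ (B.transposeHom p (b + 1)).toLinearMap

/-- The pairs `(p, q)` with `p, q ≥ 1` and `p + q = n + 1`, written as `(p, q) = (a + 1, b + 1)`. -/
abbrev Index (n : ℕ) : Type := {i : ℕ × ℕ // i.1 + i.2 + 1 = n}

instance (n : ℕ) : Finite (Index n) :=
  Set.Finite.to_subtype (Set.Finite.subset (Finset.finite_toSet (Finset.range n ×ˢ Finset.range n))
    fun i hi => by
      have : i.1 + i.2 + 1 = n := hi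
      simp; omega)

instance (n : ℕ) : Fintype (Index n) := Fintype.ofFinite _

/-- The `n`-cochains `⨁_{p + q = n + 1, p, q ≥ 1} Hom(⋀ᵖ g, ⋀^q g)`; this is `0` for `n = 0`. -/
def Cochain (_B : LieBialgebra k g) (n : ℕ) : Type (max u v) :=
  (i : Index n) → (⋀[k]^(i.1.1 + 1) g →ₗ[k] ⋀[k]^(i.1.2 + 1) g)

instance (n : ℕ) : AddCommGroup (B.Cochain n) := inferInstanceAs
  (AddCommGroup ((i : Index n) → (⋀[k]^(i.1.1 + 1) g →ₗ[k] ⋀[k]^(i.1.2 + 1) g)))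

instance (n : ℕ) : Module k (B.Cochain n) := inferInstanceAs
  (Module k ((i : Index n) → (⋀[k]^(i.1.1 + 1) g →ₗ[k] ⋀[k]^(i.1.2 + 1) g)))

/-- The component `ξ_i` of a cochain. -/
def comp {n : ℕ} (i : Index n) :
    B.Cochain n →ₗ[k] (⋀[k]^(i.1.1 + 1) g →ₗ[k] ⋀[k]^(i.1.2 + 1) g) := LinearMap.proj i

/-- The contribution of `δ_g` to the component `i` of the coboundary. -/
def dFst [CharZero k] (n : ℕ) : (i : Index (n + 1)) →
    B.Cochain n →ₗ[k] (⋀[k]^(i.1.1 + 1) g →ₗ[k] ⋀[k]^(i.1.2 + 1) g)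
  | ⟨(0, _), _⟩ => 0
  | ⟨(a + 1, b), hi⟩ =>
    B.dLeft a (b + 1) ∘ₗ B.comp (⟨(a, b), by simp at hi ⊢; omega⟩ : Index n)

/-- The contribution of `δ_{g*}` to the component `i` of the coboundary. -/
def dSnd [CharZero k] (n : ℕ) : (i : Index (n + 1)) →
    B.Cochain n →ₗ[k] (⋀[k]^(i.1.1 + 1) g →ₗ[k] ⋀[k]^(i.1.2 + 1) g)
  | ⟨(_, 0), _⟩ => 0
  | ⟨(a, b + 1), hi⟩ =>
    B.dRight (a + 1) b ∘ₗ B.comp (⟨(a, b), by simp at hi ⊢; omega⟩ : Index n)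

/-- The coboundary `δ_g + δ_{g*}` of the complex of the Lie bialgebra. -/
def d [CharZero k] (n : ℕ) : B.Cochain n →ₗ[k] B.Cochain (n + 1) :=
  LinearMap.pi fun i => B.dFst n i + B.dSnd n i

/-! ### The map to the complex of the matched pair -/

/-- `ξ̃ : ⋀ᵖ g ⊗ ⋀^{q-1} g* → g`, for `ξ ∈ Hom(⋀ᵖ g, ⋀^q g)` and `q = b + 1`:
`α (ξ̃(X, Y)) = ⟨Y ∧ α, ξ(X)⟩`. -/
def tilde (p b : ℕ) (ξ : ⋀[k]^p g →ₗ[k] ⋀[k]^(b + 1) g) :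
    ⋀[k]^p g →ₗ[k] ⋀[k]^b B.DualAlg →ₗ[k] g :=
  LinearMap.mk₂ k
    (fun X Y => (Module.evalEquiv k g).symm
      ((B.pairing (b + 1)).toLinearMap.flip (ξ X) ∘ₗ wedgeRight b Y ∘ₗ B.toDual.symm.toLinearMap))
    (fun X X' Y => by rw [← map_add]; congr 1; ext y; simp)
    (fun c X Y => by rw [← map_smul]; congr 1; ext y; simp)
    (fun X Y Y' => by rw [← map_add]; congr 1; ext y; simp)
    (fun c X Y => by rw [← map_smul]; congr 1; ext y; simp)

theorem tilde_apply (p b : ℕ) (ξ : ⋀[k]^p g →ₗ[k] ⋀[k]^(b + 1) g) (X : ⋀[k]^p g)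
    (Y : ⋀[k]^b B.DualAlg) (α : B.DualAlg) :
    B.toDual α (B.tilde p b ξ X Y) = B.pairing (b + 1) (wedgeRight b Y α) (ξ X) := by
  rw [tilde, LinearMap.mk₂_apply, Module.apply_evalEquiv_symm_apply]
  rfl

/-- `ξ̄ : ⋀^{p-1} g ⊗ ⋀^q g* → g*`, for `ξ ∈ Hom(⋀ᵖ g, ⋀^q g)` and `p = a + 1`, obtained in the same
way from `ξ* ∈ Hom(⋀^q g*, ⋀ᵖ g*)` and the interchange of `⋀^{p-1} g` and `⋀^q g*` (with its sign):
`ξ̄(X, Y)(x) = (-1)^{(p-1)q} ⟨ξ*(Y), X ∧ x⟩`. -/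
def bar (a q : ℕ) (ξ : ⋀[k]^(a + 1) g →ₗ[k] ⋀[k]^q g) :
    ⋀[k]^a g →ₗ[k] ⋀[k]^q B.DualAlg →ₗ[k] B.DualAlg :=
  LinearMap.mk₂ k
    (fun X Y => B.toDual.symm
      ((-1 : k) ^ (a * q) • (B.pairing (a + 1) (B.transposeHom (a + 1) q ξ Y) ∘ₗ wedgeRight a X)))
    (fun X X' Y => by rw [← map_add]; congr 1; ext y; simp [mul_add])
    (fun c X Y => by rw [← map_smul]; congr 1; ext y; simp; ring)
    (fun X Y Y' => by rw [← map_add]; congr 1; ext y; simp [mul_add])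
    (fun c X Y => by rw [← map_smul]; congr 1; ext y; simp; ring)

theorem bar_apply (a q : ℕ) (ξ : ⋀[k]^(a + 1) g →ₗ[k] ⋀[k]^q g) (X : ⋀[k]^a g)
    (Y : ⋀[k]^q B.DualAlg) (x : g) :
    B.toDual (B.bar a q ξ X Y) x =
      (-1) ^ (a * q) * B.pairing (a + 1) (B.transposeHom (a + 1) q ξ Y) (wedgeRight a X x) := rfl

/-- `Ψ(ξ) = ξ̃ + ξ̄`, as an alternating map on `g ⊕ g*` in `n = p + q - 1` arguments, where
`(p, q) = (a + 1, b + 1)`. -/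
def psiHom {a b n : ℕ} (e : a + b + 1 = n) (ξ : ⋀[k]^(a + 1) g →ₗ[k] ⋀[k]^(b + 1) g) :
    (g × B.DualAlg) [⋀^Fin n]→ₗ[k] (g × B.DualAlg) :=
  (LinearMap.inl k g B.DualAlg).compAlternatingMap
      (extendSum k (by omega) (B.tilde (a + 1) b ξ)) +
    (LinearMap.inr k g B.DualAlg).compAlternatingMap
      (extendSum k (by omega) (B.bar a (b + 1) ξ))

theorem psiHom_mem {a b n : ℕ} (e : a + b + 1 = n)
    (ξ : ⋀[k]^(a + 1) g →ₗ[k] ⋀[k]^(b + 1) g) :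
    B.psiHom e ξ ∈ bidegree k g B.DualAlg n a b := by
  intro s u hu
  refine ⟨fun hs => ?_, fun hs => ?_⟩
  · simp [psiHom, extendSum_eq_zero _ (B.tilde (a + 1) b ξ) hu hs]
  · simp [psiHom, extendSum_eq_zero _ (B.bar a (b + 1) ξ) hu hs]

theorem tilde_add (p b : ℕ) (ξ ξ' : ⋀[k]^p g →ₗ[k] ⋀[k]^(b + 1) g) :
    B.tilde p b (ξ + ξ') = B.tilde p b ξ + B.tilde p b ξ' := by
  refine LinearMap.ext₂ fun X Y => ?_
  rw [← sub_eq_zero, ← Module.forall_dual_apply_eq_zero_iff k]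
  intro φ
  have h := fun ζ => B.tilde_apply p b ζ X Y (B.toDual.symm φ)
  simp only [LinearEquiv.apply_symm_apply] at h
  simp [h]

theorem tilde_smul (p b : ℕ) (c : k) (ξ : ⋀[k]^p g →ₗ[k] ⋀[k]^(b + 1) g) :
    B.tilde p b (c • ξ) = c • B.tilde p b ξ := by
  refine LinearMap.ext₂ fun X Y => ?_
  rw [← sub_eq_zero, ← Module.forall_dual_apply_eq_zero_iff k]
  intro φ
  have h := fun ζ => B.tilde_apply p b ζ X Y (B.toDual.symm φ)
  simp only [LinearEquiv.apply_symm_apply] at h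
  simp [h]

theorem bar_add (a q : ℕ) (ξ ξ' : ⋀[k]^(a + 1) g →ₗ[k] ⋀[k]^q g) :
    B.bar a q (ξ + ξ') = B.bar a q ξ + B.bar a q ξ' := by
  refine LinearMap.ext₂ fun X Y => B.toDual.injective (LinearMap.ext fun x => ?_)
  simp [bar_apply, mul_add]

theorem bar_smul (a q : ℕ) (c : k) (ξ : ⋀[k]^(a + 1) g →ₗ[k] ⋀[k]^q g) :
    B.bar a q (c • ξ) = c • B.bar a q ξ := by
  refine LinearMap.ext₂ fun X Y => B.toDual.injective (LinearMap.ext fun x => ?_)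
  simp [bar_apply]
  ring

/-- The `n`-cochains of the matched pair `(g, g*, ad*_g, ad*_{g*})`. -/
abbrev MPCochain (n : ℕ) : Type (max u v) := LieMP.MPCochain B.coadLeft B.coadRight n

/-- The coboundary of the complex of the matched pair `(g, g*, ad*_g, ad*_{g*})`. -/
abbrev mpD (n : ℕ) : B.MPCochain n →ₗ[k] B.MPCochain (n + 1) :=
  LieMP.mpD B.coadLeft B.coadRight n

theorem psiHom_mem_cochain {n : ℕ} (i : Index n)
    (ξ : ⋀[k]^(i.1.1 + 1) g →ₗ[k] ⋀[k]^(i.1.2 + 1) g) :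
    B.psiHom i.2 ξ ∈ mpCochain B.coadLeft B.coadRight n := by
  cases n with
  | zero => exact absurd i.2 (by omega)
  | succ n => exact Submodule.mem_iSup_of_mem i (B.psiHom_mem i.2 ξ)

/-- `Ψ : Hom(⋀ᵖ g, ⋀^q g) → C^{p-1|q-1}`, `ξ ↦ ξ̃ + ξ̄`, into the `n`-cochains, `p + q = n + 1`. -/
def psiComponent {n : ℕ} (i : Index n) :
    (⋀[k]^(i.1.1 + 1) g →ₗ[k] ⋀[k]^(i.1.2 + 1) g) →ₗ[k] B.MPCochain n :=
  LinearMap.codRestrict (mpCochain B.coadLeft B.coadRight n)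
    { toFun := fun ξ => B.psiHom i.2 ξ
      map_add' := fun ξ ξ' => by
        ext1 x
        simp [psiHom, tilde_add, bar_add]
      map_smul' := fun c ξ => by
        ext1 x
        simp [psiHom, tilde_smul, bar_smul] }
    (fun ξ => B.psiHom_mem_cochain i ξ)

/-- The map `Ψ` on `n`-cochains, `(ξ_i)_i ↦ ∑ i, (ξ̃_i + ξ̄_i)`. -/
def psi (n : ℕ) : B.Cochain n →ₗ[k] B.MPCochain n :=
  ∑ i : Index n, B.psiComponent i ∘ₗ B.comp i

end LieBialgebra

end LieBialgebra

/-- The cochain complex with spaces `C n` and coboundaries `d n`. -/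
def complexOf {k : Type u} [Field k] (C : ℕ → Type w) [∀ n, AddCommGroup (C n)]
    [∀ n, Module k (C n)] (d : ∀ n, C n →ₗ[k] C (n + 1)) (hd : ∀ n, d (n + 1) ∘ₗ d n = 0) :
    CochainComplex (ModuleCat.{w} k) ℕ :=
  CochainComplex.of (fun n => ModuleCat.of k (C n)) (fun n => ModuleCat.ofHom (d n))
    (fun n => by rw [← ModuleCat.ofHom_comp, hd]; rfl)

/-- The morphism of cochain complexes with components `f n`. -/
def complexMap {k : Type u} [Field k] {C D : ℕ → Type w} [∀ n, AddCommGroup (C n)]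
    [∀ n, Module k (C n)] [∀ n, AddCommGroup (D n)] [∀ n, Module k (D n)]
    {d : ∀ n, C n →ₗ[k] C (n + 1)} (hd : ∀ n, d (n + 1) ∘ₗ d n = 0)
    {d' : ∀ n, D n →ₗ[k] D (n + 1)} (hd' : ∀ n, d' (n + 1) ∘ₗ d' n = 0)
    (f : ∀ n, C n →ₗ[k] D n) (hf : ∀ n, d' n ∘ₗ f n = f (n + 1) ∘ₗ d n) :
    complexOf C d hd ⟶ complexOf D d' hd' :=
  CochainComplex.ofHom (fun n => ModuleCat.ofHom (f n)) (fun n => by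
    simp only [complexOf, CochainComplex.of_d]
    rw [← ModuleCat.ofHom_comp, ← ModuleCat.ofHom_comp, hf])

/-- The maps `Φ n` on cohomology are induced by the morphism `F` of cochain complexes: the class of
each `n`-cocycle `z` is sent to the class of `F z`. -/
def Induces {k : Type u} [Field k] {K L : CochainComplex (ModuleCat.{w} k) ℕ} (F : K ⟶ L)
    (Φ : ∀ n, K.homology n ⟶ L.homology n) : Prop :=
  ∀ n, K.homologyπ n ≫ Φ n = HomologicalComplex.cyclesMap F n ≫ L.homologyπ n

end

end LieMP

/-! Everything takes place on the Drinfeld double, the space D = g ⊕ g* with the bracket π. It is a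
Lie algebra because the two coadjoint actions form a matched pair, and the compatibility axioms of
that pair are the cocycle condition on δ tested against pairs of covectors (`toDual_lie_lie`). For
any Lie bracket π, the operator F ↦ -[π, F] is the Chevalley–Eilenberg coboundary with adjoint
coefficients (`neg_nrBracket_bracket`). Hence δ_MPL is the adjoint coboundary of D restricted to a
subspace, and its square vanishes by Cartan calculus (`ced_ced`).

An element ξ of Hom(⋀ᵖ g, ⋀^q g) is the same thing as a scalar form ω_ξ on D of bidegree (p, q),
namely `formOf`. Two facts about these forms carry the proof.

The scalar coboundary of D satisfies dω_ξ = ω_{δ_g ξ} + ω_{δ_{g*} ξ} (`ced_formOf`). On p + 1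
vectors of g and q covectors, the terms of dω_ξ that keep too many vectors of g vanish. What remains
is the bracket of g and its coadjoint action on the covectors, that is δ_g. The case of q + 1
covectors is the mirror image, the sign in ξ* being that of the interchange of the two blocks.

The natural pairing of D is nondegenerate and invariant (`eq_of_pairD`, `pairD_lie`). If ⟨v, F⟩ = c
ι_v ω for all v, invariance and Cartan's formula give ⟨v, dF⟩ = -c ι_v dω
(`compAlternatingMap_ceD_eq_contraction`). By `pairD_psiDouble`, F = Ψ(ξ) is of this kind, with ω =
ω_ξ and c = (-1)^n for n the number of arguments: ξ̃ and ξ̄ are the two contractions of one form.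

Together these facts show that Ψ commutes with the coboundaries (`mpD_comp_psi`). Moreover Ψ is
injective, since the form recovers ξ, so δ_LieBi squares to zero because δ_MPL does (`d_comp_d`).
The statement on cohomology is then formal. -/

namespace LieMP

/-! ### Contractions of alternating maps and of alternatizations. -/

section Uncurry

variable {k : Type*} [Field k]
variable {V : Type*} [AddCommGroup V] [Module k V]
variable {W : Type*} [AddCommGroup W] [Module k W]

/-- Reduces an identity to its contractions with a vector; this is what drives the inductions on the
number of arguments. -/
theorem alternatingMap_ext_curryLeft {n : ℕ} {f f' : V [⋀^Fin (n + 1)]→ₗ[k] W}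
    (h : ∀ u, f.curryLeft u = f'.curryLeft u) : f = f' := by
  ext v
  have := congrArg (fun F => F (Fin.tail v)) (h (v 0))
  simpa [Matrix.vecCons] using this

/-- Polarization of ι_{u+v} ι_{u+v} = 0. -/
theorem curryLeft_curryLeft_swap {n : ℕ} (f : V [⋀^Fin (n + 2)]→ₗ[k] W) (u v : V) :
    (f.curryLeft u).curryLeft v = -(f.curryLeft v).curryLeft u := by
  have h := f.curryLeft_same (u + v)
  have e : ∀ a b : V, ((f.curryLeft (a + b)).curryLeft (a + b)) =
      (f.curryLeft a).curryLeft a + (f.curryLeft a).curryLeft b +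
      ((f.curryLeft b).curryLeft a + (f.curryLeft b).curryLeft b) := by
    intro a b
    simp only [map_add, AlternatingMap.curryLeft_add, LinearMap.add_apply]
    abel
  rw [e, f.curryLeft_same, f.curryLeft_same, zero_add, add_zero] at h
  exact eq_neg_of_add_eq_zero_left h

/-- `w ↦ ι_u (φ w)`. -/
noncomputable def contractComp {n : ℕ} (φ : V →ₗ[k] V [⋀^Fin (n + 1)]→ₗ[k] W) (u : V) :
    V →ₗ[k] V [⋀^Fin n]→ₗ[k] W :=
  (LinearMap.applyₗ u) ∘ₗ AlternatingMap.curryLeftLinearMap ∘ₗ φ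

@[simp] theorem contractComp_apply {n : ℕ} (φ : V →ₗ[k] V [⋀^Fin (n + 1)]→ₗ[k] W) (u w : V) :
    contractComp φ u w = (φ w).curryLeft u := rfl

theorem curryLeft_alternatizeUncurryFin_zero (φ : V →ₗ[k] V [⋀^Fin 0]→ₗ[k] W) (u : V) :
    (AlternatingMap.alternatizeUncurryFin φ).curryLeft u = φ u := by
  ext v
  rw [AlternatingMap.curryLeft_apply_apply, AlternatingMap.alternatizeUncurryFin_apply]
  simp

/-- The term i = 0 of the alternating sum has u in the coefficient slot. In all later terms u stays
the first argument and the index shifts by one, whence the minus sign. -/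
theorem curryLeft_alternatizeUncurryFin {n : ℕ} (φ : V →ₗ[k] V [⋀^Fin (n + 1)]→ₗ[k] W) (u : V) :
    (AlternatingMap.alternatizeUncurryFin φ).curryLeft u =
      φ u - AlternatingMap.alternatizeUncurryFin (contractComp φ u) := by
  ext v
  rw [AlternatingMap.curryLeft_apply_apply, AlternatingMap.alternatizeUncurryFin_apply,
    Fin.sum_univ_succ, AlternatingMap.sub_apply, AlternatingMap.alternatizeUncurryFin_apply,
    sub_eq_add_neg, ← Finset.sum_neg_distrib]
  congr 1
  · simp [Matrix.vecCons]
  · refine Finset.sum_congr rfl fun i _ => ?_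
    have : i.succ.removeNth (Matrix.vecCons u v) = Matrix.vecCons u (i.removeNth v) := by
      ext j
      refine Fin.cases ?_ (fun j => ?_) j <;> simp [Fin.removeNth_apply]
    rw [this, contractComp_apply, AlternatingMap.curryLeft_apply_apply]
    simp [pow_succ]

/-- Moving A vᵢ from position i to the front costs (-1)ⁱ, which is the sign in the alternatization.
-/
theorem derivAlt_eq_alternatizeUncurryFin {n : ℕ} (A : V →ₗ[k] V) (f : V [⋀^Fin (n + 1)]→ₗ[k] W) :
    derivAlt A f = AlternatingMap.alternatizeUncurryFin (f.curryLeft ∘ₗ A) := by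
  ext v
  rw [derivAlt_apply, AlternatingMap.alternatizeUncurryFin_apply]
  refine Finset.sum_congr rfl fun i _ => ?_
  rw [LinearMap.comp_apply, AlternatingMap.curryLeft_apply_apply,
    ← AlternatingMap.neg_one_pow_smul_map_insertNth, Fin.insertNth_removeNth, smul_smul, ← pow_add,
    Even.neg_one_pow ⟨_, rfl⟩, one_smul]

theorem curryLeft_derivAlt {n : ℕ} (A : V →ₗ[k] V) (f : V [⋀^Fin (n + 1)]→ₗ[k] W) (u : V) :
    (derivAlt A f).curryLeft u = f.curryLeft (A u) + derivAlt A (f.curryLeft u) := by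
  ext v
  simp only [AlternatingMap.curryLeft_apply_apply, derivAlt_apply, Fin.sum_univ_succ,
    AlternatingMap.add_apply]
  congr 1
  · simp [Matrix.vecCons]
  · refine Finset.sum_congr rfl fun i _ => ?_
    congr 1
    ext j
    refine Fin.cases ?_ (fun j => ?_) j
    · rw [Function.update_of_ne (Fin.succ_ne_zero i).symm]; rfl
    · simp [Matrix.vecCons, Function.update_apply]

end Uncurry

/-! ### Cartan calculus for Chevalley–Eilenberg cochains, and d² = 0. -/

section Cartan

variable {k : Type*} [Field k]
variable {L : Type*} [LieRing L] [LieAlgebra k L]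
variable {W : Type*} [AddCommGroup W] [Module k W]

/-- The Lie derivative of a cochain. -/
noncomputable def lieAct {n : ℕ} (ρ : L →ₗ[k] W →ₗ[k] W) (u : L) (f : L [⋀^Fin n]→ₗ[k] W) :
    L [⋀^Fin n]→ₗ[k] W :=
  (ρ u).compAlternatingMap f - derivAlt (lieBr k L u) f

/-- The part of the Chevalley–Eilenberg coboundary that contains the action on the coefficients. -/
noncomputable def ceCoef {n : ℕ} (ρ : L →ₗ[k] W →ₗ[k] W) (f : L [⋀^Fin n]→ₗ[k] W) :
    L [⋀^Fin (n + 1)]→ₗ[k] W := AlternatingMap.alternatizeUncurryFin (actComp ρ f)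

theorem ceCoef_apply {n : ℕ} (ρ : L →ₗ[k] W →ₗ[k] W) (f : L [⋀^Fin n]→ₗ[k] W)
    (x : Fin (n + 1) → L) :
    ceCoef ρ f x = ∑ i : Fin (n + 1), (-1 : ℤ) ^ (i : ℕ) • ρ (x i) (f (i.removeNth x)) := by
  rw [ceCoef, AlternatingMap.alternatizeUncurryFin_apply]; rfl

/-- `(v, w) ↦ ι_[v, w] f`. -/
noncomputable def brCurry {m : ℕ} (f : L [⋀^Fin (m + 1)]→ₗ[k] W) :
    L →ₗ[k] L →ₗ[k] L [⋀^Fin m]→ₗ[k] W :=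
  (LinearMap.llcomp k L L _ f.curryLeft).comp (lieBr k L)

@[simp] theorem brCurry_apply {m : ℕ} (f : L [⋀^Fin (m + 1)]→ₗ[k] W) (v w : L) :
    brCurry f v w = f.curryLeft ⁅v, w⁆ := rfl

/-- The part of the Chevalley–Eilenberg coboundary that contains the bracket. -/
noncomputable def ceBr {m : ℕ} (f : L [⋀^Fin (m + 1)]→ₗ[k] W) : L [⋀^Fin (m + 2)]→ₗ[k] W :=
  (2⁻¹ : k) • AlternatingMap.alternatizeUncurryFin
    (AlternatingMap.alternatizeUncurryFinLM ∘ₗ brCurry f)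

theorem curryLeft_ceCoef {n : ℕ} (ρ : L →ₗ[k] W →ₗ[k] W) (f : L [⋀^Fin (n + 1)]→ₗ[k] W) (u : L) :
    (ceCoef ρ f).curryLeft u = (ρ u).compAlternatingMap f - ceCoef ρ (f.curryLeft u) := by
  rw [ceCoef, curryLeft_alternatizeUncurryFin]; rfl

theorem curryLeft_lie_skew {m : ℕ} (f : L [⋀^Fin (m + 1)]→ₗ[k] W) (u v : L) :
    f.curryLeft ⁅v, u⁆ = -f.curryLeft ⁅u, v⁆ := by
  rw [← map_neg, lie_skew]

theorem alternatizeUncurryFin_neg {n : ℕ} (φ : L →ₗ[k] L [⋀^Fin n]→ₗ[k] W) :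
    AlternatingMap.alternatizeUncurryFin (-φ) = -AlternatingMap.alternatizeUncurryFin φ := by
  rw [← neg_one_smul k φ, AlternatingMap.alternatizeUncurryFin_smul, neg_one_smul]

/-- The Cartan relation L_u ι_v - ι_v L_u = ι_{[u, v]}. -/
theorem curryLeft_lieAct {n : ℕ} (ρ : L →ₗ[k] W →ₗ[k] W) (f : L [⋀^Fin (n + 1)]→ₗ[k] W)
    (u v : L) :
    (lieAct ρ u f).curryLeft v = lieAct ρ u (f.curryLeft v) - f.curryLeft ⁅u, v⁆ := by
  rw [lieAct, sub_eq_add_neg, AlternatingMap.curryLeft_add, LinearMap.add_apply]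
  have hneg : (-derivAlt (lieBr k L u) f).curryLeft v =
    -(derivAlt (lieBr k L u) f).curryLeft v := rfl
  rw [hneg, curryLeft_derivAlt, lieAct, AlternatingMap.curryLeft_compAlternatingMap, lieBr_apply]
  abel

theorem lieAct_sub {n : ℕ} (ρ : L →ₗ[k] W →ₗ[k] W) (f f' : L [⋀^Fin n]→ₗ[k] W) (u : L) :
    lieAct ρ u (f - f') = lieAct ρ u f - lieAct ρ u f' := by
  ext v; simp [lieAct, derivAlt_apply]; abel

/-- After contraction with w, the Cartan relation leaves the same identity with one argument fewer,
plus contractions with double brackets that cancel by Jacobi. With no arguments left, the identity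
is the representation property of ρ. -/
theorem lieAct_lie {n : ℕ} (ρ : L →ₗ[k] W →ₗ[k] W)
    (hρ : ∀ x y w, ρ ⁅x, y⁆ w = ρ x (ρ y w) - ρ y (ρ x w)) (f : L [⋀^Fin n]→ₗ[k] W)
    (u v : L) : lieAct ρ ⁅u, v⁆ f = lieAct ρ u (lieAct ρ v f) - lieAct ρ v (lieAct ρ u f) := by
  induction n with
  | zero => ext x; simp [lieAct, derivAlt_apply, hρ]
  | succ n ih =>
    refine alternatingMap_ext_curryLeft fun w => ?_
    have hs : ∀ F F' : L [⋀^Fin (n + 1)]→ₗ[k] W, (F - F').curryLeft w =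
      F.curryLeft w - F'.curryLeft w := fun _ _ => rfl
    rw [hs]
    simp only [curryLeft_lieAct, lieAct_sub]
    rw [ih, lie_lie, map_sub]
    abel

variable [CharZero k]

/-- The Chevalley–Eilenberg coboundary on cochains in any number of arguments. -/
noncomputable def ced (ρ : L →ₗ[k] W →ₗ[k] W) : (n : ℕ) → (L [⋀^Fin n]→ₗ[k] W) →
    (L [⋀^Fin (n + 1)]→ₗ[k] W)
  | 0, f => AlternatingMap.alternatizeUncurryFin (actComp ρ f)
  | _ + 1, f => ceD ρ f

theorem ceD_eq_ceAux {m : ℕ} (ρ : L →ₗ[k] W →ₗ[k] W) (f : L [⋀^Fin (m + 1)]→ₗ[k] W) :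
    ceD ρ f = ceAux ρ f := by
  ext x; rw [ceAux_apply, ceD_apply]

theorem ceD_eq_sub {m : ℕ} (ρ : L →ₗ[k] W →ₗ[k] W) (f : L [⋀^Fin (m + 1)]→ₗ[k] W) :
    ceD ρ f = ceCoef ρ f - ceBr f := ceD_eq_ceAux ρ f

theorem ceD_eq_coef_add {m : ℕ} (ρ : L →ₗ[k] W →ₗ[k] W) (f : L [⋀^Fin (m + 1)]→ₗ[k] W) :
    ceD ρ f = ceCoef ρ f + ceD 0 f := by
  have : ceCoef 0 f = 0 := by ext x; simp [ceCoef_apply]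
  rw [ceD_eq_sub, ceD_eq_sub, this]; abel

theorem half_smul_add_self {M : Type*} [AddCommGroup M] [Module k M] (x : M) :
    (2⁻¹ : k) • (x + x) = x := by
  rw [← two_smul k x, smul_smul, inv_mul_cancel₀ two_ne_zero, one_smul]

theorem curryLeft_ceBr_zero (f : L [⋀^Fin 1]→ₗ[k] W) (u : L) :
    (ceBr f).curryLeft u = derivAlt (lieBr k L u) f := by
  rw [ceBr, AlternatingMap.curryLeft_smul, LinearMap.smul_apply, curryLeft_alternatizeUncurryFin]
  have h1 : (AlternatingMap.alternatizeUncurryFinLM ∘ₗ brCurry f) u =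
      derivAlt (lieBr k L u) f := by
    rw [derivAlt_eq_alternatizeUncurryFin]; rfl
  have h2 : contractComp (AlternatingMap.alternatizeUncurryFinLM ∘ₗ brCurry f) u =
      -(f.curryLeft ∘ₗ lieBr k L u) := by
    ext1 v
    change (AlternatingMap.alternatizeUncurryFin (brCurry f v)).curryLeft u = _
    rw [curryLeft_alternatizeUncurryFin_zero, brCurry_apply, curryLeft_lie_skew]
    rfl
  rw [h1, h2, alternatizeUncurryFin_neg, ← derivAlt_eq_alternatizeUncurryFin, sub_neg_eq_add,
    half_smul_add_self]

/-- The vector u can enter either slot of the bracket, and by skew-symmetry both give the same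
derivation term. The factor 1/2 in `ceBr` compensates for this. -/
theorem curryLeft_ceBr {m : ℕ} (f : L [⋀^Fin (m + 2)]→ₗ[k] W) (u : L) :
    (ceBr f).curryLeft u = derivAlt (lieBr k L u) f - ceBr (f.curryLeft u) := by
  rw [ceBr, AlternatingMap.curryLeft_smul, LinearMap.smul_apply, curryLeft_alternatizeUncurryFin]
  have h1 : (AlternatingMap.alternatizeUncurryFinLM ∘ₗ brCurry f) u =
      derivAlt (lieBr k L u) f := by
    rw [derivAlt_eq_alternatizeUncurryFin]; rfl
  have h2 : contractComp (AlternatingMap.alternatizeUncurryFinLM ∘ₗ brCurry f) u =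
      -(f.curryLeft ∘ₗ lieBr k L u) +
        AlternatingMap.alternatizeUncurryFinLM ∘ₗ brCurry (f.curryLeft u) := by
    ext1 v
    change (AlternatingMap.alternatizeUncurryFin (brCurry f v)).curryLeft u = _
    have h3 : contractComp (brCurry f v) u = -brCurry (f.curryLeft u) v := by
      ext1 w
      simp [curryLeft_curryLeft_swap f u]
    rw [curryLeft_alternatizeUncurryFin, brCurry_apply, curryLeft_lie_skew, h3,
      alternatizeUncurryFin_neg, sub_neg_eq_add]
    rfl
  rw [h1, h2, AlternatingMap.alternatizeUncurryFin_add, alternatizeUncurryFin_neg,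
    ← derivAlt_eq_alternatizeUncurryFin, ceBr]
  generalize derivAlt (lieBr k L u) f = X
  generalize AlternatingMap.alternatizeUncurryFin
    (AlternatingMap.alternatizeUncurryFinLM ∘ₗ brCurry (f.curryLeft u)) = Y
  rw [show X - (-X + Y) = (X + X) - Y by abel, smul_sub, half_smul_add_self]

theorem curryLeft_ced_zero (ρ : L →ₗ[k] W →ₗ[k] W) (f : L [⋀^Fin 0]→ₗ[k] W) (u : L) :
    (ced ρ 0 f).curryLeft u = lieAct ρ u f := by
  rw [ced, curryLeft_alternatizeUncurryFin_zero, lieAct]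
  ext v
  simp [derivAlt_apply, actComp]

/-- Cartan's formula ι_u d + d ι_u = L_u. Together with `curryLeft_ced_zero` it determines d
recursively, so later arguments need not return to the explicit double sum. -/
theorem curryLeft_ced_succ (ρ : L →ₗ[k] W →ₗ[k] W) (n : ℕ) (f : L [⋀^Fin (n + 1)]→ₗ[k] W) (u : L) :
    (ced ρ (n + 1) f).curryLeft u = lieAct ρ u f - ced ρ n (f.curryLeft u) := by
  rw [ced, ceD_eq_sub, sub_eq_add_neg, AlternatingMap.curryLeft_add, LinearMap.add_apply,
    curryLeft_ceCoef]
  have hneg : (-ceBr f).curryLeft u = -(ceBr f).curryLeft u := rfl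
  rw [hneg]
  cases n with
  | zero =>
    rw [curryLeft_ceBr_zero, ced, lieAct, ceCoef]; abel
  | succ n =>
    rw [curryLeft_ceBr, ced, lieAct, ceD_eq_sub]; abel

theorem ced_sub (ρ : L →ₗ[k] W →ₗ[k] W) (n : ℕ) (f f' : L [⋀^Fin n]→ₗ[k] W) :
    ced ρ n (f - f') = ced ρ n f - ced ρ n f' := by
  cases n with
  | zero => ext v; simp [ced, AlternatingMap.alternatizeUncurryFin_apply, actComp]
  | succ n => simp [ced]

/-- L_u commutes with ι_w up to ι_{[u, w]}; by Cartan's formula the commutator of d and L_u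
therefore contracts to the commutator in one degree less, plus L_{[u, w]} - [L_u, L_w] = 0. -/
theorem ced_lieAct (ρ : L →ₗ[k] W →ₗ[k] W)
    (hρ : ∀ x y w, ρ ⁅x, y⁆ w = ρ x (ρ y w) - ρ y (ρ x w)) (n : ℕ) (f : L [⋀^Fin n]→ₗ[k] W)
    (u : L) : ced ρ n (lieAct ρ u f) = lieAct ρ u (ced ρ n f) := by
  induction n with
  | zero =>
    refine alternatingMap_ext_curryLeft fun w => ?_
    rw [curryLeft_lieAct, curryLeft_ced_zero, curryLeft_ced_zero, curryLeft_ced_zero,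
      lieAct_lie ρ hρ f u w]
    abel
  | succ n ih =>
    refine alternatingMap_ext_curryLeft fun w => ?_
    rw [curryLeft_lieAct, curryLeft_ced_succ, curryLeft_ced_succ, curryLeft_ced_succ,
      lieAct_lie ρ hρ f u w, curryLeft_lieAct, ced_sub, ih, lieAct_sub]
    abel

/-- By Cartan's formula twice, ι_w d d f = L_w d f - d L_w f + d d ι_w f. The first two terms cancel
by `ced_lieAct`, the last is zero by induction. -/
theorem ced_ced (ρ : L →ₗ[k] W →ₗ[k] W)
    (hρ : ∀ x y w, ρ ⁅x, y⁆ w = ρ x (ρ y w) - ρ y (ρ x w)) (n : ℕ) (f : L [⋀^Fin n]→ₗ[k] W) :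
    ced ρ (n + 1) (ced ρ n f) = 0 := by
  induction n with
  | zero =>
    refine alternatingMap_ext_curryLeft fun w => ?_
    rw [curryLeft_ced_succ, curryLeft_ced_zero, ced_lieAct ρ hρ, sub_self]; rfl
  | succ n ih =>
    refine alternatingMap_ext_curryLeft fun w => ?_
    rw [curryLeft_ced_succ, curryLeft_ced_succ, ced_sub, ih, ced_lieAct ρ hρ]
    simp

end Cartan
-- Shuffle sums as sums over all permutations, and insertions involving a map of two arguments.
section Shuffle

/-- A permutation amounts to the image i of 0 together with a permutation of the remaining letters.
-/
theorem sum_perm_succ {V W : Type*} [AddCommGroup W] {n : ℕ} (φ : (Fin (n + 1) → V) → W)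
    (x : Fin (n + 1) → V) :
    ∑ σ : Equiv.Perm (Fin (n + 1)), Equiv.Perm.sign σ • φ (x ∘ σ) =
      ∑ i : Fin (n + 1), (-1 : ℤ) ^ (i : ℕ) • ∑ τ : Equiv.Perm (Fin n),
        Equiv.Perm.sign τ • φ (Matrix.vecCons (x i) (i.removeNth x ∘ τ)) := by
  -- The inverse cycle sends 0 to i, keeps the other letters in order, and has sign (-1)ⁱ.
  let F : Fin (n + 1) × Equiv.Perm (Fin n) → Equiv.Perm (Fin (n + 1)) := fun p =>
    (Fin.cycleRange p.1)⁻¹ * Equiv.Perm.decomposeFin.symm (0, p.2)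
  have F0 : ∀ p, F p 0 = p.1 := by
    intro p
    simp only [F, Equiv.Perm.mul_apply, Equiv.Perm.decomposeFin_symm_apply_zero]
    exact Fin.cycleRange_symm_zero _
  have F1 : ∀ p j, F p (Fin.succ j) = p.1.succAbove (p.2 j) := by
    intro p j
    simp only [F, Equiv.Perm.mul_apply, Equiv.Perm.decomposeFin_symm_apply_succ, Equiv.swap_self,
      Equiv.refl_apply]
    exact Fin.cycleRange_symm_succ _ _
  have hF : Function.Bijective F := by
    rw [Fintype.bijective_iff_injective_and_card]
    constructor
    · rintro ⟨i, τ⟩ ⟨i', τ'⟩ h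
      have h0 : i = i' := (F0 (i, τ)).symm.trans ((congrArg (fun f => f 0) h).trans (F0 (i', τ')))
      subst h0
      have := Equiv.Perm.decomposeFin.symm.injective (mul_left_cancel h)
      simpa using this
    · simp [Fintype.card_perm, Nat.factorial_succ]
  rw [← hF.sum_comp, Fintype.sum_prod_type]
  refine Finset.sum_congr rfl fun i _ => ?_
  rw [Finset.smul_sum]
  refine Finset.sum_congr rfl fun τ _ => ?_
  have hs : Equiv.Perm.sign (F (i, τ)) = (-1) ^ (i : ℕ) * Equiv.Perm.sign τ := by
    simp [F, Equiv.Perm.sign_mul, Fin.sign_cycleRange]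
  have hx : x ∘ F (i, τ) = Matrix.vecCons (x i) (i.removeNth x ∘ τ) := by
    ext j
    refine Fin.cases ?_ (fun j => ?_) j
    · simp [F0]
    · simp [F1, Fin.removeNth_apply]
  rw [hs, hx, mul_smul, Units.smul_def ((-1) ^ (i : ℕ))]
  simp

variable {k : Type*} [Field k]
variable {V : Type*} [AddCommGroup V] [Module k V]

theorem sum_perm_alternating {W : Type*} [AddCommGroup W] [Module k W] {n : ℕ}
    (f : V [⋀^Fin n]→ₗ[k] W) (x : Fin n → V) :
    ∑ τ : Equiv.Perm (Fin n), Equiv.Perm.sign τ • f (x ∘ τ) = n.factorial • f x := by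
  simp [f.map_perm, smul_smul, Fintype.card_perm]

/-- Each shuffle represents a! b! permutations with equal signed terms. Multiplying by this number
replaces the quotient by the full symmetric group, where `sum_perm_succ` applies; characteristic
zero later removes the factor. -/
theorem factorial_smul_shuffleProd {P Q : Type*} [AddCommGroup P] [Module k P] [AddCommGroup Q]
    [Module k Q] {a b n : ℕ} (e : a + b = n) (p : V [⋀^Fin a]→ₗ[k] P) (q : V [⋀^Fin b]→ₗ[k] Q)
    (x : Fin n → V) :
    (a.factorial * b.factorial) • shuffleProd e p q x =
      ∑ σ : Equiv.Perm (Fin n), Equiv.Perm.sign σ •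
        (p (fun i => x (σ (Fin.cast e (Fin.castAdd b i)))) ⊗ₜ[k]
          q (fun i => x (σ (Fin.cast e (Fin.natAdd a i))))) := by
  let E : Fin a ⊕ Fin b ≃ Fin n := finSumFinEquiv.trans (finCongr e)
  have h := congrArg (fun F => F (fun i => x (E i))) (MultilinearMap.domCoprod_alternization_eq p q)
  simp only [AlternatingMap.smul_apply, Fintype.card_fin] at h
  rw [shuffleProd, AlternatingMap.domDomCongr_apply]
  refine h.symm.trans ?_
  rw [MultilinearMap.alternatization_apply, ← Equiv.sum_comp (E.permCongr)]
  refine Finset.sum_congr rfl fun σ _ => ?_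
  rw [Equiv.Perm.sign_permCongr]
  congr 1
  rw [MultilinearMap.domDomCongr_apply, MultilinearMap.domCoprod_apply]
  have hl : ∀ i, E.symm (Fin.cast e (Fin.castAdd b i)) = Sum.inl i := by
    intro i; rw [Equiv.symm_apply_eq]; simp [E]
  have hr : ∀ i, E.symm (Fin.cast e (Fin.natAdd a i)) = Sum.inr i := by
    intro i; rw [Equiv.symm_apply_eq]; simp [E]
  simp only [Equiv.permCongr_apply, hl, hr]
  rfl

theorem factorial_smul_insertion {m n N : ℕ} (e : (m + 1) + n = N) (f : V [⋀^Fin (m + 1)]→ₗ[k] V)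
    (g : V [⋀^Fin (n + 1)]→ₗ[k] V) (x : Fin N → V) :
    ((m + 1).factorial * n.factorial) • insertion e f g x =
      ∑ σ : Equiv.Perm (Fin N), Equiv.Perm.sign σ •
        g (Matrix.vecCons (f (fun i => x (σ (Fin.cast e (Fin.castAdd n i)))))
          (fun i => x (σ (Fin.cast e (Fin.natAdd (m + 1) i))))) := by
  rw [insertion, LinearMap.compAlternatingMap_apply, ← map_nsmul, factorial_smul_shuffleProd,
    map_sum]
  refine Finset.sum_congr rfl fun σ _ => ?_
  rw [Units.smul_def, Units.smul_def, map_zsmul]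
  congr 1
  simp [evalHead]

variable [CharZero k]

theorem nsmul_left_cancel_of_charZero (k : Type*) [Field k] [CharZero k] {V : Type*}
    [AddCommGroup V] [Module k V] {n : ℕ} (hn : n ≠ 0) {x y : V} (h : n • x = n • y) :
    x = y := by
  rw [← Nat.cast_smul_eq_nsmul k, ← Nat.cast_smul_eq_nsmul k n y] at h
  exact smul_right_injective V (Nat.cast_ne_zero.2 hn) h

/-- A shuffle of type (n + 1, 1) is the choice of the one argument that f does not receive. -/
theorem insertion_right_two {n : ℕ} (e : (n + 1) + 1 = n + 2) (f : V [⋀^Fin (n + 1)]→ₗ[k] V)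
    (π : V [⋀^Fin 2]→ₗ[k] V) (x : Fin (n + 2) → V) :
    insertion e f π x =
      (-1 : ℤ) ^ (n + 1) • ∑ i : Fin (n + 2), (-1 : ℤ) ^ (i : ℕ) • π ![f (i.removeNth x), x i] := by
  have h := factorial_smul_insertion e f π x
  let φ : (Fin (n + 2) → V) → V := fun y => π ![f (Fin.tail y), y 0]
  -- The rotation brings the argument that f does not see from the last place to place 0, so that
  -- `sum_perm_succ` can split it off. Its sign is the global factor (-1)^(n+1).
  rw [← Equiv.sum_comp (Equiv.mulRight (finRotate (n + 2)))] at h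
  have h1 : ∀ σ : Equiv.Perm (Fin (n + 2)), Equiv.Perm.sign (Equiv.mulRight (finRotate (n + 2)) σ) •
        π (Matrix.vecCons (f (fun i => x (Equiv.mulRight (finRotate (n + 2)) σ
            (Fin.cast e (Fin.castAdd 1 i)))))
          (fun i => x (Equiv.mulRight (finRotate (n + 2)) σ (Fin.cast e (Fin.natAdd (n + 1) i))))) =
      (-1 : ℤ) ^ (n + 1) • Equiv.Perm.sign σ • φ (x ∘ σ) := by
    intro σ
    rw [Equiv.coe_mulRight, Equiv.Perm.sign_mul, sign_finRotate, mul_comm, mul_smul,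
      Units.smul_def ((-1) ^ _)]
    have hφ : π (Matrix.vecCons (f (fun i => x ((σ * finRotate (n + 2))
            (Fin.cast e (Fin.castAdd 1 i)))))
          (fun i => x ((σ * finRotate (n + 2)) (Fin.cast e (Fin.natAdd (n + 1) i))))) =
        φ (x ∘ σ) := by
      congr 1
      ext i
      refine Fin.cases ?_ (fun j => ?_) i
      · change f _ = f _
        congr 1
        ext i
        simp only [Equiv.Perm.mul_apply, Fin.tail, Function.comp_apply]
        congr 2
        exact finRotate_of_lt (n := n + 1) (k := i) i.2
      · fin_cases j
        change x _ = x _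
        simp only [Equiv.Perm.mul_apply]
        congr 2
        exact finRotate_last
    rw [hφ]
    simp
  simp only [h1] at h
  rw [← Finset.smul_sum, sum_perm_succ φ] at h
  have h2 : ∀ i : Fin (n + 2), ∑ τ : Equiv.Perm (Fin (n + 1)), Equiv.Perm.sign τ •
      φ (Matrix.vecCons (x i) (i.removeNth x ∘ τ)) =
      (n + 1).factorial • π ![f (i.removeNth x), x i] := by
    intro i
    let T : V →ₗ[k] V :=
      { toFun := fun w => π ![w, x i]
        map_add' := fun w w' => π.map_vecCons_add _ _ _
        map_smul' := fun c w => π.map_vecCons_smul _ _ _ }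
    exact sum_perm_alternating (T.compAlternatingMap f) (i.removeNth x)
  simp only [h2, Nat.factorial_one, mul_one, smul_comm _ (n + 1).factorial] at h
  rw [← Finset.smul_sum, smul_comm _ (n + 1).factorial] at h
  exact nsmul_left_cancel_of_charZero k (Nat.factorial_ne_zero (n + 1)) h

/-- Splitting off two letters in turn gives a sum over ordered pairs, whereas a shuffle only chooses
an unordered pair; hence the factor 2. -/
theorem insertion_left_two {n : ℕ} (e : (1 + 1) + n = n + 2) (f : V [⋀^Fin (n + 1)]→ₗ[k] V)
    (π : V [⋀^Fin 2]→ₗ[k] V) (x : Fin (n + 2) → V) :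
    2 • insertion e π f x =
      ∑ i : Fin (n + 2), (-1 : ℤ) ^ (i : ℕ) • ∑ j : Fin (n + 1), (-1 : ℤ) ^ (j : ℕ) •
        f (Matrix.vecCons (π ![x i, i.removeNth x j]) (j.removeNth (i.removeNth x))) := by
  have h := factorial_smul_insertion e π f x
  let φ : (Fin (n + 2) → V) → V := fun y =>
    f (Matrix.vecCons (π ![y 0, y 1]) (Fin.tail (Fin.tail y)))
  have h1 : ∀ σ : Equiv.Perm (Fin (n + 2)),
        f (Matrix.vecCons (π (fun i => x (σ (Fin.cast e (Fin.castAdd n i)))))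
          (fun i => x (σ (Fin.cast e (Fin.natAdd (1 + 1) i))))) = φ (x ∘ σ) := by
    intro σ
    congr 2
    · congr 1
      ext i
      fin_cases i <;> rfl
    · ext i
      simp only [Fin.tail, Function.comp_apply]
      congr 2
      ext
      simp only [Fin.val_cast, Fin.val_natAdd, Fin.val_succ]
      omega
  simp only [h1] at h
  rw [sum_perm_succ φ] at h
  have h2 : ∀ i : Fin (n + 2), ∑ τ : Equiv.Perm (Fin (n + 1)), Equiv.Perm.sign τ •
      φ (Matrix.vecCons (x i) (i.removeNth x ∘ τ)) =
      n.factorial • ∑ j : Fin (n + 1), (-1 : ℤ) ^ (j : ℕ) •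
        f (Matrix.vecCons (π ![x i, i.removeNth x j]) (j.removeNth (i.removeNth x))) := by
    intro i
    refine (sum_perm_succ (fun y : Fin (n + 1) → V =>
      f (Matrix.vecCons (π ![x i, y 0]) (Fin.tail y))) (i.removeNth x)).trans ?_
    rw [Finset.smul_sum]
    refine Finset.sum_congr rfl fun j _ => ?_
    rw [smul_comm n.factorial]
    congr 1
    exact sum_perm_alternating (f.curryLeft (π ![x i, i.removeNth x j]))
      (j.removeNth (i.removeNth x))
  simp only [h2, smul_comm _ n.factorial] at h
  rw [← Finset.smul_sum, mul_comm, mul_smul] at h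
  exact nsmul_left_cancel_of_charZero k (Nat.factorial_ne_zero n) h

end Shuffle
-- The Nijenhuis–Richardson bracket with a Lie bracket is the adjoint coboundary.
section Adjoint

variable {k : Type*} [Field k]
variable {L : Type*} [LieRing L] [LieAlgebra k L]

theorem lieBr_self (v : L) : lieBr k L v v = 0 := lie_self v

variable [CharZero k]

theorem insertion_bracket_right {n : ℕ} (e : (n + 1) + 1 = n + 2) (F : L [⋀^Fin (n + 1)]→ₗ[k] L) :
    insertion e F (alt₂ (lieBr k L) lieBr_self) = (-1 : ℤ) ^ n • ceCoef (lieBr k L) F := by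
  ext x
  rw [insertion_right_two, AlternatingMap.smul_apply, ceCoef_apply, pow_succ, mul_smul,
    neg_one_smul, ← Finset.sum_neg_distrib]
  congr 1
  refine Finset.sum_congr rfl fun i _ => ?_
  rw [← smul_neg]
  congr 1
  rw [alt₂_apply, lieBr_apply, lie_skew, lieBr_apply]
  rfl

theorem insertion_bracket_left {n : ℕ} (e : (1 + 1) + n = n + 2) (F : L [⋀^Fin (n + 1)]→ₗ[k] L) :
    insertion e (alt₂ (lieBr k L) lieBr_self) F = ceBr F := by
  ext x
  refine nsmul_left_cancel_of_charZero k two_ne_zero ?_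
  rw [insertion_left_two, ceBr, AlternatingMap.smul_apply, ← Nat.cast_smul_eq_nsmul k, smul_smul,
    Nat.cast_ofNat, mul_inv_cancel₀ two_ne_zero, one_smul,
    AlternatingMap.alternatizeUncurryFin_apply]
  refine Finset.sum_congr rfl fun i _ => ?_
  rw [LinearMap.comp_apply, AlternatingMap.alternatizeUncurryFinLM_apply,
    AlternatingMap.alternatizeUncurryFin_apply]
  rfl

/-- Inserting the bracket into F gives the bracket part of the coboundary, and inserting F into the
bracket gives (-1)ⁿ times the coefficient part. That sign cancels the (-1)^(1·n) in the definition
of the Nijenhuis–Richardson bracket. -/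
theorem neg_nrBracket_bracket {n : ℕ} (e : 1 + n + 1 = n + 2) (F : L [⋀^Fin (n + 1)]→ₗ[k] L) :
    -nrBracket e (alt₂ (lieBr k L) lieBr_self) F = ceD (lieBr k L) F := by
  rw [nrBracket, insertion_bracket_left, insertion_bracket_right, ceD_eq_sub, one_mul, smul_smul,
    ← pow_add, Even.neg_one_pow ⟨_, rfl⟩, one_smul, neg_sub]

end Adjoint

/-! ### The bicrossed product Lie algebra and the square of δ_MPL. -/

section Bicrossed

variable {k : Type*} [Field k]
variable {g : Type*} [LieRing g] [LieAlgebra k g]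
variable {h : Type*} [LieRing h] [LieAlgebra k h]
variable {ρ : g →ₗ[k] h →ₗ[k] h} {ψ : h →ₗ[k] g →ₗ[k] g}

/-- The bicrossed product of a matched pair of Lie algebras. -/
def Bicrossed (_H : IsMatchedPair ρ ψ) : Type _ := g × h

variable (H : IsMatchedPair ρ ψ)

instance : AddCommGroup (Bicrossed H) := inferInstanceAs (AddCommGroup (g × h))

instance : Module k (Bicrossed H) := inferInstanceAs (Module k (g × h))

theorem mpPi_apply (u v : g × h) : mpPi ρ ψ ![u, v] =
    (⁅u.1, v.1⁆ + (ψ u.2 v.1 - ψ v.2 u.1), ρ u.1 v.2 - ρ v.1 u.2 + ⁅u.2, v.2⁆) := rfl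

/-- The g- and h-components of the Jacobi identity for π split into the Jacobi identities of g and
h, the two representation properties and the two compatibility conditions. -/
instance : LieRing (Bicrossed H) where
  bracket u v := (mpPi ρ ψ ![u, v] : g × h)
  add_lie u v w := (mpPi ρ ψ).map_vecCons_add _ _ _
  lie_add u v w := ((mpPi ρ ψ).curryLeft u).map_vecCons_add _ _ _
  lie_self u := (mpPi ρ ψ).map_eq_zero_of_eq _ (i := 0) (j := 1) rfl (by simp)
  leibniz_lie u v w := by
    obtain ⟨x, a⟩ := u
    obtain ⟨y, b⟩ := v
    obtain ⟨z, c⟩ := w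
    change mpPi ρ ψ ![(x, a), mpPi ρ ψ ![(y, b), (z, c)]] =
      mpPi ρ ψ ![mpPi ρ ψ ![(x, a), (y, b)], (z, c)] +
      mpPi ρ ψ ![(y, b), mpPi ρ ψ ![(x, a), (z, c)]]
    simp only [mpPi_apply, Prod.mk_add_mk, Prod.mk.injEq, map_add, map_sub, LinearMap.add_apply,
      LinearMap.sub_apply, lie_add, lie_sub, add_lie, sub_lie, H.rep_left, H.rep_right,
      H.compat_left, H.compat_right]
    constructor
    · rw [leibniz_lie x y z, ← lie_skew (ψ c x) y]
      abel
    · rw [leibniz_lie a b c, ← lie_skew (ρ z a) b]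
      abel

instance : LieAlgebra k (Bicrossed H) where
  lie_smul _ u _ := ((mpPi ρ ψ).curryLeft u).map_vecCons_smul _ _ _

variable [CharZero k]

/-- In positive degree this is `neg_nrBracket_bracket`. In degree 0 it says -π(u, v) = [v, u], the
adjoint action of v on the constant u. -/
theorem mpDelta_eq_ced (n : ℕ) (F : Bicrossed H [⋀^Fin n]→ₗ[k] Bicrossed H) :
    mpDelta ρ ψ n F = ced (lieBr k (Bicrossed H)) n F := by
  cases n with
  | zero =>
    refine alternatingMap_ext_curryLeft (V := Bicrossed H) (W := Bicrossed H) fun u => ?_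
    refine Eq.trans ?_ (curryLeft_ced_zero _ F u).symm
    refine AlternatingMap.ext fun v => ?_
    obtain rfl : v = ![] := Subsingleton.elim _ _
    change -(⁅F ![], u⁆ : Bicrossed H) = _
    rw [lie_skew]
    change ⁅u, F ![]⁆ = ⁅u, F ![]⁆ - derivAlt (lieBr k (Bicrossed H) u) F ![]
    rw [derivAlt_apply, Finset.univ_eq_empty, Finset.sum_empty, sub_zero]
  | succ n =>
    rw [ced, ← neg_nrBracket_bracket (by omega)]
    rfl

theorem mpD_comp_mpD (H : IsMatchedPair ρ ψ) (n : ℕ) : mpD ρ ψ (n + 1) ∘ₗ mpD ρ ψ n = 0 := by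
  ext1 F
  apply Subtype.ext
  change mpDelta ρ ψ (n + 1) (mpDelta ρ ψ n F.1) = 0
  refine (mpDelta_eq_ced H (n + 1) (mpDelta ρ ψ n F.1)).trans ?_
  refine (congrArg (ced (lieBr k (Bicrossed H)) (n + 1)) (mpDelta_eq_ced H n F.1)).trans ?_
  exact ced_ced (L := Bicrossed H) (W := Bicrossed H) _ (fun x y w => lie_lie x y w) n F.1

end Bicrossed
-- Cochains as functions on lists, where blocks of arguments concatenate without index arithmetic.
section Lists

variable {V V' W W' X X' : Type*}

/-- `[v₁, …, vₙ] ↦ ∑ i, φ [v₁, …, A vᵢ, …, vₙ]`. -/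
def derList [AddCommGroup W] (A : V → V) : (List V → W) → List V → W
  | _, [] => 0
  | φ, v :: l => φ (A v :: l) + derList A (fun l' => φ (v :: l')) l

/-- `[v₀, …, vₙ] ↦ ∑ i, (-1)ⁱ c vᵢ (ψ [v₀, …, v̂ᵢ, …, vₙ])`. -/
def coefList [AddCommGroup W] (c : V → X → W) : (List V → X) → List V → W
  | _, [] => 0
  | ψ, v :: l => c v (ψ l) - coefList c (fun l' => ψ (v :: l')) l

/-- The Chevalley–Eilenberg coboundary with trivial coefficients of a function on lists. -/
def dList [AddCommGroup W] (br : V → V → V) : (List V → W) → List V → W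
  | _, [] => 0
  | φ, v :: l => -derList (br v) φ l - dList br (fun l' => φ (v :: l')) l

section Functions

variable [AddCommGroup W] [AddCommGroup W']

theorem derList_append (A : V → V) (φ : List V → W) (l₁ l₂ : List V) :
    derList A φ (l₁ ++ l₂) =
      derList A (fun l => φ (l ++ l₂)) l₁ + derList A (fun l => φ (l₁ ++ l)) l₂ := by
  induction l₁ generalizing φ with
  | nil => simp [derList]
  | cons v l ih => simp only [List.cons_append, derList, ih, add_assoc]

/-- The brackets fall into three kinds: both entries in `l₁`; both in `l₂`, with the sign for
passing `l₁`; and one in each, where an entry of `l₁` acts on `l₂` as a derivation. -/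
theorem dList_append (br : V → V → V) (φ : List V → W) (l₁ l₂ : List V) :
    dList br φ (l₁ ++ l₂) = dList br (fun l => φ (l ++ l₂)) l₁ +
      (-1 : ℤ) ^ l₁.length • dList br (fun l => φ (l₁ ++ l)) l₂ +
      coefList (fun u (G : List V → W) => -derList (br u) G l₂) (fun l l' => φ (l ++ l')) l₁ := by
  induction l₁ generalizing φ with
  | nil => simp [dList, coefList]
  | cons v l ih =>
    simp only [List.cons_append, dList, ih, derList_append, coefList, List.length_cons, pow_succ,
      mul_neg, mul_one, neg_smul]
    abel

/-- The hypothesis compares values of φ only. Thus A may differ from A' by components that φ kills,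
as happens for the mixed brackets of the double. -/
theorem derList_map (j : V' → V) (A : V → V) (A' : V' → V') (φ : List V → W) (l : List V')
    (h : ∀ l₁ a l₂, φ (l₁.map j ++ A (j a) :: l₂.map j) = φ ((l₁ ++ A' a :: l₂).map j)) :
    derList A φ (l.map j) = derList A' (fun l' => φ (l'.map j)) l := by
  induction l generalizing φ with
  | nil => rfl
  | cons a l ih =>
    simp only [List.map_cons, derList]
    rw [ih (fun l' => φ (j a :: l')) fun l₁ b l₂ => h (a :: l₁) b l₂]
    congr 1
    exact h [] a l

theorem dList_map (i : V' → V) (br : V → V → V) (br' : V' → V' → V') (φ : List V → W)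
    (l : List V') (h : ∀ x y, br (i x) (i y) = i (br' x y)) :
    dList br φ (l.map i) = dList br' (fun l' => φ (l'.map i)) l := by
  induction l generalizing φ with
  | nil => rfl
  | cons a l ih =>
    simp only [List.map_cons, dList]
    rw [ih, derList_map i (br (i a)) (br' a)]
    intro l₁ b l₂
    simp [h]

theorem coefList_map (i : V' → V) (c : V → X → W) (ψ : List V → X) (l : List V') :
    coefList c ψ (l.map i) = coefList (fun x => c (i x)) (fun l' => ψ (l'.map i)) l := by
  induction l generalizing ψ with
  | nil => rfl
  | cons a l ih => simp only [List.map_cons, coefList, ih]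

theorem map_coefList (T : W →+ W') (c : V → X → W) (ψ : List V → X) (c' : V → X' → W')
    (ψ' : List V → X') (l : List V)
    (h : ∀ u l', l'.length + 1 = l.length → T (c u (ψ l')) = c' u (ψ' l')) :
    T (coefList c ψ l) = coefList c' ψ' l := by
  induction l generalizing ψ ψ' with
  | nil => simp [coefList]
  | cons a l ih =>
    simp only [coefList, map_sub]
    rw [h a l rfl, ih]
    intro u l' hl'
    exact h u (a :: l') (by simp [hl'])

theorem map_derList (T : W →+ W') (A : V → V) (φ : List V → W) (l : List V) :
    T (derList A φ l) = derList A (fun l' => T (φ l')) l := by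
  induction l generalizing φ with
  | nil => simp [derList]
  | cons a l ih => simp only [derList, map_add, ih]

theorem map_dList (T : W →+ W') (br : V → V → V) (φ : List V → W) (l : List V) :
    T (dList br φ l) = dList br (fun l' => T (φ l')) l := by
  induction l generalizing φ with
  | nil => simp [dList]
  | cons a l ih => simp only [dList, map_sub, map_neg, map_derList, ih]

theorem derList_eq_zero (A : V → V) (φ : List V → W) (l : List V)
    (h : ∀ l', l'.length = l.length → φ l' = 0) : derList A φ l = 0 := by
  induction l generalizing φ with
  | nil => rfl
  | cons a l ih =>
    simp only [derList]
    rw [h _ (by simp), ih, add_zero]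
    intro l' hl'
    exact h _ (by simp [hl'])

theorem dList_eq_zero (br : V → V → V) (φ : List V → W) (l : List V)
    (h : ∀ l', l'.length + 1 = l.length → φ l' = 0) : dList br φ l = 0 := by
  induction l generalizing φ with
  | nil => rfl
  | cons a l ih =>
    simp only [dList]
    rw [derList_eq_zero _ _ _ fun l' hl' => h l' (by simp [hl']), ih, sub_zero, neg_zero]
    intro l' hl'
    exact h _ (by simp [hl'])

end Functions

section Eval

variable {k : Type*} [Field k]
variable [AddCommGroup V] [Module k V] [AddCommGroup W] [Module k W]

/-- The value of an alternating map on a list; it is `0` if the list has the wrong length. -/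
def ev {n : ℕ} (f : V [⋀^Fin n]→ₗ[k] W) (l : List V) : W :=
  if h : l.length = n then f (fun i => l.get (i.cast h.symm)) else 0

theorem ev_of_length_ne {n : ℕ} (f : V [⋀^Fin n]→ₗ[k] W) {l : List V} (h : l.length ≠ n) :
    ev f l = 0 := dif_neg h

@[simp] theorem ev_ofFn {n : ℕ} (f : V [⋀^Fin n]→ₗ[k] W) (v : Fin n → V) :
    ev f (List.ofFn v) = f v := by
  rw [ev, dif_pos (List.length_ofFn)]
  congr 1
  ext i
  simp

theorem ev_cons {n : ℕ} (f : V [⋀^Fin (n + 1)]→ₗ[k] W) (u : V) (l : List V) :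
    ev f (u :: l) = ev (f.curryLeft u) l := by
  by_cases h : l.length = n
  · subst h
    rw [ev, dif_pos (List.length_cons), ev, dif_pos rfl, AlternatingMap.curryLeft_apply_apply]
    congr 1
    ext i
    refine Fin.cases ?_ (fun j => ?_) i <;> rfl
  · rw [ev_of_length_ne _ h, ev_of_length_ne _ (by simpa using h)]

theorem ev_zero_cons (f : V [⋀^Fin 0]→ₗ[k] W) (u : V) (l : List V) : ev f (u :: l) = 0 :=
  ev_of_length_ne _ (by simp)

theorem ev_succ_nil {n : ℕ} (f : V [⋀^Fin (n + 1)]→ₗ[k] W) : ev f [] = 0 :=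
  ev_of_length_ne _ (by simp)

/-- `ev` as an additive map in the alternating map. -/
def evHom (k : Type*) [Field k] [Module k V] [Module k W] (n : ℕ) (l : List V) :
    (V [⋀^Fin n]→ₗ[k] W) →+ W where
  toFun f := ev f l
  map_zero' := by simp [ev]
  map_add' f f' := by by_cases h : l.length = n <;> simp [ev, h]

@[simp] theorem evHom_apply {n : ℕ} (f : V [⋀^Fin n]→ₗ[k] W) (l : List V) :
    evHom k n l f = ev f l := rfl

theorem ev_zero {n : ℕ} (l : List V) : ev (0 : V [⋀^Fin n]→ₗ[k] W) l = 0 :=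
  map_zero (evHom k n l)

theorem ev_add {n : ℕ} (f f' : V [⋀^Fin n]→ₗ[k] W) (l : List V) :
    ev (f + f') l = ev f l + ev f' l := map_add (evHom k n l) f f'

theorem ev_sub {n : ℕ} (f f' : V [⋀^Fin n]→ₗ[k] W) (l : List V) :
    ev (f - f') l = ev f l - ev f' l := map_sub (evHom k n l) f f'

theorem ev_neg {n : ℕ} (f : V [⋀^Fin n]→ₗ[k] W) (l : List V) :
    ev (-f) l = -ev f l := map_neg (evHom k n l) f

theorem ev_comp {W' : Type*} [AddCommGroup W'] [Module k W'] {n : ℕ} (T : W →ₗ[k] W')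
    (f : V [⋀^Fin n]→ₗ[k] W) (l : List V) : ev (T.compAlternatingMap f) l = T (ev f l) := by
  by_cases h : l.length = n <;> simp [ev, h]

theorem ev_append_cons_add {n : ℕ} (f : V [⋀^Fin n]→ₗ[k] W) (l₁ l₂ : List V) (u v : V) :
    ev f (l₁ ++ (u + v) :: l₂) = ev f (l₁ ++ u :: l₂) + ev f (l₁ ++ v :: l₂) := by
  induction n generalizing l₁ with
  | zero => simp [ev]
  | succ n ih =>
    cases l₁ with
    | nil => simp only [List.nil_append, ev_cons, map_add, ev_add]
    | cons a l => simp only [List.cons_append, ev_cons, ih]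

/-- The sign of moving an entry to the front; it holds without a length condition because `ev` is 0
on lists of the wrong length. -/
theorem ev_append_cons {n : ℕ} (f : V [⋀^Fin n]→ₗ[k] W) (l₁ l₂ : List V) (u : V) :
    ev f (l₁ ++ u :: l₂) = (-1 : ℤ) ^ l₁.length • ev f (u :: (l₁ ++ l₂)) := by
  induction n generalizing l₁ with
  | zero => simp [ev]
  | succ n ih =>
    cases l₁ with
    | nil => simp
    | cons a l =>
      simp only [List.cons_append, ev_cons, ih]
      cases n with
      | zero => simp [ev]
      | succ n =>
        simp only [ev_cons, curryLeft_curryLeft_swap f a u, ev_neg, List.length_cons, pow_succ,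
          mul_neg, mul_one, neg_smul, smul_neg]

theorem ev_append_comm {n : ℕ} (f : V [⋀^Fin n]→ₗ[k] W) (l₁ l₂ : List V) :
    ev f (l₁ ++ l₂) = (-1 : ℤ) ^ (l₁.length * l₂.length) • ev f (l₂ ++ l₁) := by
  induction l₂ generalizing n with
  | nil => simp
  | cons u l ih =>
    rw [ev_append_cons]
    cases n with
    | zero => simp [ev]
    | succ n =>
      rw [ev_cons, ih, List.cons_append, ev_cons, smul_smul, ← pow_add, List.length_cons, mul_add,
        mul_one, add_comm]

theorem ev_derivAlt {n : ℕ} (A : V →ₗ[k] V) (f : V [⋀^Fin n]→ₗ[k] W) (l : List V) :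
    ev (derivAlt A f) l = derList A (ev f) l := by
  induction l generalizing n with
  | nil =>
    cases n with
    | zero => simp [ev, derivAlt_apply, derList]
    | succ n => rw [ev_succ_nil]; rfl
  | cons u l ih =>
    cases n with
    | zero => rw [derList_eq_zero _ _ _ fun l' hl' => ev_of_length_ne _ (by simp [hl']), ev_zero_cons]
    | succ n => simp only [ev_cons, curryLeft_derivAlt, ev_add, derList, ih]

variable {L : Type*} [LieRing L] [LieAlgebra k L]

theorem ev_ceCoef {n : ℕ} (ρ : L →ₗ[k] W →ₗ[k] W) (f : L [⋀^Fin n]→ₗ[k] W) (l : List L) :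
    ev (ceCoef ρ f) l = coefList (fun u w => ρ u w) (ev f) l := by
  induction l generalizing n with
  | nil => rw [ev_succ_nil]; rfl
  | cons u l ih =>
    rw [ev_cons, coefList]
    cases n with
    | zero =>
      have h : coefList (fun u w => ρ u w) (fun l' => ev f (u :: l')) l = 0 := by
        simp only [ev_zero_cons]
        have := ih (0 : L [⋀^Fin 0]→ₗ[k] W)
        have h0 : ev (0 : L [⋀^Fin 0]→ₗ[k] W) = fun _ => 0 := by ext l'; exact ev_zero l'
        rw [h0] at this
        rw [← this]
        have h1 : ceCoef ρ (0 : L [⋀^Fin 0]→ₗ[k] W) = 0 := by ext x; simp [ceCoef_apply]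
        rw [h1, ev_zero]
      rw [h, sub_zero, ceCoef, curryLeft_alternatizeUncurryFin_zero]
      exact ev_comp (ρ u) f l
    | succ n =>
      rw [curryLeft_ceCoef, ev_sub, ih, ev_comp]
      simp only [ev_cons]

variable [CharZero k]

/-- For trivial coefficients L_u is minus a derivation, and Cartan's formula becomes the recursion
that defines `dList`. -/
theorem ev_ced_zero {n : ℕ} (f : L [⋀^Fin n]→ₗ[k] W) (l : List L) :
    ev (ced 0 n f) l = dList (fun x y => ⁅x, y⁆) (ev f) l := by
  induction l generalizing n with
  | nil => rw [ev_succ_nil]; rfl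
  | cons u l ih =>
    have h : ev (lieAct 0 u f) l = -derList (fun y => ⁅u, y⁆) (ev f) l := by
      have h0 : lieAct 0 u f = -derivAlt (lieBr k L u) f := by
        ext x; simp [lieAct]
      rw [h0, ev_neg, ev_derivAlt]
      rfl
    rw [ev_cons, dList]
    cases n with
    | zero =>
      rw [curryLeft_ced_zero, h, dList_eq_zero _ _ _ fun l' _ => ev_zero_cons f u l', sub_zero]
    | succ n =>
      rw [curryLeft_ced_succ, ev_sub, h, ih]
      simp only [ev_cons]

theorem ev_ceD {m : ℕ} (ρ : L →ₗ[k] W →ₗ[k] W) (f : L [⋀^Fin (m + 1)]→ₗ[k] W) (l : List L) :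
    ev (ceD ρ f) l =
      coefList (fun u w => ρ u w) (ev f) l + dList (fun x y => ⁅x, y⁆) (ev f) l := by
  rw [ceD_eq_coef_add, ev_add, ev_ceCoef, ← ev_ced_zero]
  rfl

/-- The coboundary of a form `ω` on a Lie algebra `D` that contains `L` and `M`, where
`ω` is given by a cochain `f` of `L` with coefficients in a module `W` of forms on `M`. -/
theorem ev_ced_mixed {D M : Type*} [LieRing D] [LieAlgebra k D] [AddCommGroup M] [Module k M]
    {m q N : ℕ} (i : L → D) (j : M → D) (r : L → M →ₗ[k] M) (s : L → M → L)
    (ρ : L →ₗ[k] W →ₗ[k] W) (P : W →ₗ[k] M [⋀^Fin q]→ₗ[k] k)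
    (hi : ∀ x y, ⁅i x, i y⁆ = i ⁅x, y⁆) (hij : ∀ x a, ⁅i x, j a⁆ = j (r x a) + i (s x a))
    (hP : ∀ x w, P (ρ x w) = -derivAlt (r x) (P w))
    (f : L [⋀^Fin (m + 1)]→ₗ[k] W) (ω : D [⋀^Fin N]→ₗ[k] k)
    (hω : ∀ x a, ev ω (x.map i ++ a.map j) = ev (P (ev f x)) a)
    (hvan : ∀ (x : List L) l, m + 2 ≤ x.length → ev ω (x.map i ++ l) = 0)
    (x : List L) (hx : m + 2 ≤ x.length) (a : List M) :
    ev (ced 0 N ω) (x.map i ++ a.map j) = ev (P (ev (ceD ρ f) x)) a := by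
  let T : W →+ k := (evHom k q a).comp P.toAddMonoidHom
  have hT : ∀ w, ev (P w) a = T w := fun _ => rfl
  -- Brackets of two entries of `a` leave all of `x` in place, so `hvan` kills them. Brackets inside
  -- `x` match the bracket part of `ceD`, and mixed brackets match its coefficient part.
  rw [ev_ced_zero, dList_append, hT, ev_ceD, map_add, map_dList,
    dList_map i _ _ _ x hi, coefList_map,
    dList_eq_zero _ (fun l => ev ω (x.map i ++ l)) _ fun l _ => hvan x l hx, smul_zero, add_zero,
    add_comm]
  congr 1
  · symm
    refine map_coefList T _ _ _ _ _ fun u x' hx' => ?_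
    rw [derList_map j _ (r u)]
    · simp only [hω]
      rw [← ev_derivAlt, ← ev_neg, ← hP]
      rfl
    · intro l₁ b l₂
      -- The component of the mixed bracket in L replaces the removed entry u, so there are again at
      -- least m + 2 entries from L and ω vanishes. Only the component in M survives.
      have h0 := hvan (s u b :: x') (l₁.map j ++ l₂.map j) (by simp only [List.length_cons]; omega)
      rw [List.map_cons, List.cons_append, ← List.append_assoc] at h0
      rw [hij, ← List.append_assoc, ev_append_cons_add, ev_append_cons ω _ _ (i (s u b)), h0,
        smul_zero, add_zero, List.append_assoc, List.map_append, List.map_cons]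
  · simp only [hω]
    rfl

end Eval

end Lists
-- Alternating maps on a direct sum, evaluated on sorted pure tuples.
section PureTuples

variable {k : Type*} [Field k]
variable {g h W : Type*} [AddCommGroup g] [Module k g] [AddCommGroup h] [Module k h]
  [AddCommGroup W] [Module k W]

theorem neg_one_pow_smul_cancel {A : Type*} [AddCommGroup A] {n : ℕ} {x y : A}
    (h : (-1 : ℤ) ^ n • x = (-1 : ℤ) ^ n • y) : x = y := by
  have := congrArg ((-1 : ℤ) ^ n • ·) h
  simpa only [smul_smul, ← pow_add, Even.neg_one_pow ⟨n, rfl⟩, one_smul] using this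

/-- By linearity it suffices to contract with vectors of one summand at a time. A contracted vector
of h moves behind the block from g at the cost of a sign common to both sides. -/
theorem eq_of_ev_inl_inr {n : ℕ} {f f' : (g × h) [⋀^Fin n]→ₗ[k] W}
    (hf : ∀ (x : List g) (y : List h),
      ev f (x.map (LinearMap.inl k g h) ++ y.map (LinearMap.inr k g h)) =
      ev f' (x.map (LinearMap.inl k g h) ++ y.map (LinearMap.inr k g h))) : f = f' := by
  induction n with
  | zero =>
    ext v
    have := hf [] []
    simp only [List.map_nil, List.append_nil] at this
    rw [← ev_ofFn f, ← ev_ofFn f']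
    simpa using this
  | succ n ih =>
    refine alternatingMap_ext_curryLeft fun u => ?_
    have h1 : f.curryLeft (LinearMap.inl k g h u.1) = f'.curryLeft (LinearMap.inl k g h u.1) := by
      refine ih fun x y => ?_
      simpa only [ev_cons, List.map_cons, List.cons_append] using hf (u.1 :: x) y
    have h2 : f.curryLeft (LinearMap.inr k g h u.2) = f'.curryLeft (LinearMap.inr k g h u.2) := by
      refine ih fun x y => ?_
      have h3 := hf x (u.2 :: y)
      rw [List.map_cons, ev_append_cons, ev_append_cons, ev_cons, ev_cons] at h3
      exact neg_one_pow_smul_cancel h3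
    have hu : u = LinearMap.inl k g h u.1 + LinearMap.inr k g h u.2 := by ext <;> simp
    rw [hu, map_add, map_add, h1, h2]

end PureTuples

section ExtendSum

variable {k : Type*} [Field k]
variable {g : Type*} [LieRing g] [LieAlgebra k g]
variable {h : Type*} [LieRing h] [LieAlgebra k h]
variable {W : Type*} [AddCommGroup W] [Module k W]

/-- Only the trivial shuffle contributes: any other one puts a vector of h into the g-block, where
the projection to g kills it. -/
theorem extendSum_append {a b : ℕ} (θ : ⋀[k]^a g →ₗ[k] ⋀[k]^b h →ₗ[k] W)
    (x : Fin a → g) (y : Fin b → h) :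
    extendSum k rfl θ (Fin.append (LinearMap.inl k g h ∘ x) (LinearMap.inr k g h ∘ y)) =
      θ (exteriorPower.ιMulti k a x) (exteriorPower.ιMulti k b y) := by
  change TensorProduct.lift θ (shuffleProd rfl _ _ _) = _
  rw [shuffleProd, AlternatingMap.domDomCongr_apply, AlternatingMap.domCoprod_apply,
    _root_.sum_apply, map_sum]
  refine (Finset.sum_eq_single (Quotient.mk'' (1 : Equiv.Perm (Fin a ⊕ Fin b)) :
    Equiv.Perm.ModSumCongr (Fin a) (Fin b)) ?_ ?_).trans ?_
  rotate_left 2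
  · rw [AlternatingMap.domCoprod.summand_mk'', _root_.smul_apply,
      MultilinearMap.domDomCongr_apply, MultilinearMap.domCoprod_apply]
    simp [Function.comp_def]
  · intro σ _ hσ
    induction σ using Quotient.inductionOn' with | _ σ
    rw [AlternatingMap.domCoprod.summand_mk'', _root_.smul_apply,
      MultilinearMap.domDomCongr_apply, MultilinearMap.domCoprod_apply]
    by_cases hl : ∀ i, ∃ i', σ (Sum.inl i) = Sum.inl i'
    · exfalso
      refine hσ (Quotient.sound' ?_)
      -- A permutation that preserves the first block also preserves the second, hence lies in the
      -- subgroup and represents the trivial class.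
      rw [QuotientGroup.leftRel_apply, mul_one, inv_mem_iff]
      refine Equiv.Perm.mem_sumCongrHom_range_of_perm_mapsTo_inl ?_
      rintro _ ⟨i, rfl⟩
      obtain ⟨i', hi'⟩ := hl i
      exact ⟨i', hi'.symm⟩
    · push Not at hl
      obtain ⟨i, hi⟩ := hl
      obtain ⟨j, hj⟩ : ∃ j, σ (Sum.inl i) = Sum.inr j := by
        cases hs : σ (Sum.inl i) with
        | inl i' => exact absurd hs (hi i')
        | inr j => exact ⟨j, rfl⟩
      have : ((exteriorPower.ιMulti k a).compLinearMap (LinearMap.fst k g h))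
          (fun i => Fin.append (LinearMap.inl k g h ∘ x) (LinearMap.inr k g h ∘ y)
            ((finSumFinEquiv.trans (finCongr rfl)) (σ (Sum.inl i)))) = 0 := by
        rw [AlternatingMap.compLinearMap_apply]
        exact AlternatingMap.map_coord_zero _ i (by simp [hj])
      refine (congrArg _ ?_).trans (map_zero (TensorProduct.lift θ))
      refine (congrArg _ ?_).trans (smul_zero (Equiv.Perm.sign σ))
      exact (congrArg (· ⊗ₜ[k] _) this).trans (TensorProduct.zero_tmul _ _)
  · simp

theorem ev_extendSum {a b n : ℕ} (e : a + b = n) (θ : ⋀[k]^a g →ₗ[k] ⋀[k]^b h →ₗ[k] W)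
    (x : List g) (y : List h) :
    ev (extendSum k e θ) (x.map (LinearMap.inl k g h) ++ y.map (LinearMap.inr k g h)) =
      θ (ev (exteriorPower.ιMulti k a) x) (ev (exteriorPower.ιMulti k b) y) := by
  by_cases hn : x.length + y.length = n
  · by_cases ha : x.length = a
    · obtain rfl : y.length = b := by omega
      subst ha e
      have hx : x = List.ofFn x.get := (List.ofFn_get x).symm
      have hy : y = List.ofFn y.get := (List.ofFn_get y).symm
      have hxy : x.map (LinearMap.inl k g h) ++ y.map (LinearMap.inr k g h) =
          List.ofFn (Fin.append (LinearMap.inl k g h ∘ x.get) (LinearMap.inr k g h ∘ y.get)) := by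
        rw [List.ofFn_fin_append, ← List.map_ofFn, ← List.map_ofFn, ← hx, ← hy]
      rw [hxy, ev_ofFn, extendSum_append, ← ev_ofFn (exteriorPower.ιMulti k _) x.get,
        ← ev_ofFn (exteriorPower.ιMulti k _) y.get, ← hx, ← hy]
    · rw [ev_of_length_ne (exteriorPower.ιMulti k a) ha, map_zero, LinearMap.zero_apply]
      rw [ev, dif_pos (by simpa using hn)]
      have hc : (Finset.univ.filter fun i : Fin n => (i : ℕ) < x.length).card = x.length := by
        rw [Fin.card_filter_val_lt]; omega
      -- The positions of the vectors of g are the initial ones; their number differs from a, so the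
      -- tuple is pure of the wrong type.
      refine extendSum_eq_zero e θ (s := Finset.univ.filter fun i => (i : ℕ) < x.length) ?_ ?_
      · intro i
        simp only [Finset.mem_filter, Finset.mem_univ, true_and, List.get_eq_getElem,
          Fin.val_cast]
        constructor
        · intro hi
          rw [List.getElem_append_left (by simpa using hi)]
          simp
        · intro hi
          rw [List.getElem_append_right (by simpa using hi)]
          simp
      · rw [hc]; tauto
  · rw [ev_of_length_ne _ (by simpa using hn)]
    by_cases ha : x.length = a
    · rw [ev_of_length_ne (exteriorPower.ιMulti k b) (by omega), map_zero]
    · rw [ev_of_length_ne (exteriorPower.ιMulti k a) ha, map_zero, LinearMap.zero_apply]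

end ExtendSum

/-! ### Derivations of exterior powers and the determinant pairing. -/

section Duality

/-- In the Leibniz expansion both sides replace one factor M(σ l, l) by C(σ l, l) and sum over that
factor, indexed once by its column and once by its row. -/
theorem sum_det_updateCol_eq_sum_det_updateRow {R : Type*} [CommRing R] {n : ℕ}
    (M C : Matrix (Fin n) (Fin n) R) :
    ∑ j, (M.updateCol j fun i => C i j).det = ∑ i, (M.updateRow i (C i)).det := by
  simp only [Matrix.det_apply]
  rw [Finset.sum_comm, Finset.sum_comm (s := Finset.univ (α := Fin n))]
  refine Finset.sum_congr rfl fun σ _ => ?_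
  rw [← Equiv.sum_comp σ (fun i => Equiv.Perm.sign σ • ∏ l, M.updateRow i (C i) (σ l) l)]
  refine Finset.sum_congr rfl fun j _ => ?_
  congr 1
  refine Finset.prod_congr rfl fun l _ => ?_
  by_cases h : l = j
  · subst h; simp
  · rw [Matrix.updateCol_ne h, Matrix.updateRow_ne (σ.injective.ne h)]

variable {k : Type*} [Field k]
variable {V : Type*} [AddCommGroup V] [Module k V]

theorem extDer_ιMulti {n : ℕ} (A : V →ₗ[k] V) (v : Fin n → V) :
    extDer n A (exteriorPower.ιMulti k n v) = derivAlt A (exteriorPower.ιMulti k n) v := by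
  change exteriorPower.alternatingMapLinearEquiv _ _ = _
  rw [exteriorPower.alternatingMapLinearEquiv_apply_ιMulti]

variable [FiniteDimensional k V]

/-- If A' is minus the transpose of A, the same holds for the derivation extensions. On decomposable
elements A' changes one column of the pairing matrix and A changes one row, so the determinant
identity above applies. -/
theorem powDual_extDer {n : ℕ} (A : V →ₗ[k] V) (A' : Module.Dual k V →ₗ[k] Module.Dual k V)
    (h : ∀ α v, A' α v = -α (A v)) (Y : ⋀[k]^n (Module.Dual k V)) (X : ⋀[k]^n V) :
    powDual k V n (extDer n A' Y) X = -powDual k V n Y (extDer n A X) := by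
  have key : (powDual k V n).toLinearMap ∘ₗ extDer n A' =
      -((powDual k V n).toLinearMap.flip ∘ₗ extDer n A).flip := by
    refine exteriorPower.linearMap_ext (AlternatingMap.ext fun α => ?_)
    refine exteriorPower.linearMap_ext (AlternatingMap.ext fun v => ?_)
    simp only [LinearMap.compAlternatingMap_apply, LinearMap.comp_apply, LinearMap.neg_apply,
      LinearMap.flip_apply, LinearEquiv.coe_coe, extDer_ιMulti, derivAlt_apply, map_sum,
      LinearMap.sum_apply, powDual_ιMulti]
    have h1 := sum_det_updateCol_eq_sum_det_updateRow (Matrix.of fun i j => α j (v i))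
      (Matrix.of fun i j => α j (A (v i)))
    have h2 : ∀ j, (Matrix.of fun i j' => Function.update α j (A' (α j)) j' (v i)).det =
        -((Matrix.of fun i j => α j (v i)).updateCol j fun i => α j (A (v i))).det := by
      intro j
      have : (Matrix.of fun i j' => Function.update α j (A' (α j)) j' (v i)) =
          (Matrix.of fun i j => α j (v i)).updateCol j ((-1 : k) • fun i => α j (A (v i))) := by
        ext i j'
        by_cases hj : j' = j
        · subst hj; simp [h]
        · simp [hj]
      rw [this, Matrix.det_updateCol_smul, neg_one_mul]
    have h3 : ∀ i, (Matrix.of fun i' j => α j (Function.update v i (A (v i)) i')).det =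
        ((Matrix.of fun i j => α j (v i)).updateRow i fun j => α j (A (v i))).det := by
      intro i
      congr 1
      ext i' j
      by_cases hi : i' = i
      · subst hi; simp
      · simp [hi]
    simp only [h2, h3, Finset.sum_neg_distrib]
    exact congrArg Neg.neg h1
  exact congrArg (fun F => F Y X) key

theorem powDual_cobracketOf (ν : (Module.Dual k V) [⋀^Fin 2]→ₗ[k] (Module.Dual k V))
    (α β : Module.Dual k V) (x : V) :
    powDual k V 2 (exteriorPower.ιMulti k 2 ![α, β]) (cobracketOf ν x) = ν ![α, β] x := by
  have h : transposeEquiv V (⋀[k]^2 V) (cobracketOf ν) =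
      exteriorPower.alternatingMapLinearEquiv ν ∘ₗ (powDual k V 2).symm.toLinearMap :=
    LinearEquiv.apply_symm_apply _ _
  have h' := congrArg (fun F => F (powDual k V 2 (exteriorPower.ιMulti k 2 ![α, β])) x) h
  refine Eq.trans h' ?_
  simp

end Duality

/-! ### The coadjoint actions of a Lie bialgebra form a matched pair. -/

namespace LieBialgebra

variable {k : Type u} {g : Type v} [Field k] [LieRing g] [LieAlgebra k g]
  [FiniteDimensional k g] (B : LieBialgebra k g)

theorem pairing_extDer_coadLeft {n : ℕ} (x : g) (Y : ⋀[k]^n B.DualAlg) (X : ⋀[k]^n g) :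
    B.pairing n Y (extDer n (lieBr k g x) X) = -B.pairing n (extDer n (B.coadLeft x) Y) X := by
  rw [eq_neg_iff_add_eq_zero, ← eq_neg_iff_add_eq_zero.mp (powDual_extDer (k := k) (V := g)
    (lieBr k g x) (B.coadLeft x) (fun α v => B.coadLeft_apply x α v) Y X), add_comm]
  rfl

theorem pairing_extDer_lie {n : ℕ} (α : B.DualAlg) (Y : ⋀[k]^n B.DualAlg) (X : ⋀[k]^n g) :
    B.pairing n (extDer n (lieBr k B.DualAlg α) Y) X =
      -B.pairing n Y (extDer n (B.coadRight α) X) :=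
  powDual_extDer (k := k) (V := g) (B.coadRight α) (lieBr k B.DualAlg α)
    (fun β v => by
      rw [eq_neg_iff_add_eq_zero, add_comm]
      exact eq_neg_iff_add_eq_zero.mp (B.coadRight_apply α β v)) Y X

/-- The cocycle condition paired with α ∧ β, with the adjoint action on ⋀² g moved to the covectors.
Both compatibility axioms of the matched pair are rearrangements of this one identity. -/
theorem toDual_lie_lie (α β : B.DualAlg) (x y : g) :
    B.toDual ⁅α, β⁆ ⁅x, y⁆ =
      -B.toDual ⁅B.coadLeft x α, β⁆ y - B.toDual ⁅α, B.coadLeft x β⁆ y +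
      B.toDual ⁅B.coadLeft y α, β⁆ x + B.toDual ⁅α, B.coadLeft y β⁆ x := by
  have h0 : ∀ (a b : B.DualAlg) z, B.pairing 2 (exteriorPower.ιMulti k 2 ![a, b])
      (cobracketOf B.dualBracket z) = B.toDual ⁅a, b⁆ z :=
    fun a b z => powDual_cobracketOf B.dualBracket a b z
  have h1 : ∀ z w : g, B.pairing 2 (exteriorPower.ιMulti k 2 ![α, β])
      (extDer 2 (lieBr k g z) (cobracketOf B.dualBracket w)) =
      -(B.toDual ⁅B.coadLeft z α, β⁆ w + B.toDual ⁅α, B.coadLeft z β⁆ w) := by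
    intro z w
    have hl : Function.update ![α, β] 0 (B.coadLeft z α) = ![B.coadLeft z α, β] := by
      ext i : 1; fin_cases i <;> rfl
    have hr : Function.update ![α, β] 1 (B.coadLeft z β) = ![α, B.coadLeft z β] := by
      ext i : 1; fin_cases i <;> rfl
    rw [pairing_extDer_coadLeft, extDer_ιMulti, derivAlt_apply, Fin.sum_univ_two]
    simp only [Matrix.cons_val_zero, Matrix.cons_val_one, hl, hr, map_add, LinearMap.add_apply, h0]
  rw [← h0 α β, B.cocycle x y, map_sub, h1, h1]
  ring

theorem ext_toDual {x y : g} (h : ∀ β : B.DualAlg, B.toDual β x = B.toDual β y) : x = y := by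
  rw [← sub_eq_zero, ← Module.forall_dual_apply_eq_zero_iff k]
  intro φ
  rw [map_sub, sub_eq_zero]
  exact h (B.toDual.symm φ)

/-- The coadjoint actions form a matched pair. -/
theorem isMatchedPair : IsMatchedPair B.coadLeft B.coadRight where
  rep_left x y a := B.toDual.injective (LinearMap.ext fun z => by
    simp [coadLeft_apply, lie_lie])
  rep_right a b x := B.ext_toDual fun β => by
    simp [coadRight_apply, lie_lie]
  compat_left x a b := B.toDual.injective (LinearMap.ext fun y => by
    -- The two coadjoint actions are removed by their defining relations, so that every term becomes
    -- a bracket of g* evaluated at a vector of g.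
    have h1 : ∀ c d : B.DualAlg, B.toDual (B.coadLeft (B.coadRight c x) d) y =
        B.toDual ⁅c, B.coadLeft y d⁆ x := by
      intro c d
      rw [coadLeft_apply, ← lie_skew, map_neg, neg_neg, ← neg_neg (B.toDual d _),
        ← coadLeft_apply, coadRight_apply, neg_neg]
    simp only [map_add, map_sub, LinearMap.add_apply, LinearMap.sub_apply, h1]
    rw [coadLeft_apply, toDual_lie_lie, ← lie_skew b, map_neg, LinearMap.neg_apply]
    ring)
  compat_right a x y := B.ext_toDual fun b => by
    simp only [map_add, map_sub, coadRight_apply]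
    have h1 : ∀ z w : g, B.toDual b ⁅z, B.coadRight a w⁆ = B.toDual ⁅a, B.coadLeft z b⁆ w := by
      intro z w
      rw [← neg_neg (B.toDual b _), ← coadLeft_apply, coadRight_apply, neg_neg]
    rw [toDual_lie_lie, ← lie_skew (B.coadRight a x) y, map_neg, h1, h1]
    ring

end LieBialgebra

/-! ### Vanishing of forms with too many entries from one summand, and forms on exterior powers. -/

section Vanishing

variable {k : Type*} [Field k]
variable {D : Type*} [AddCommGroup D] [Module k D] {L M : Type*}

/-- Each vector of `l` splits into its two components. The L-component moves to the front and only
lengthens `x`, so vanishing on sorted tuples is enough. -/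
theorem ev_map_append_eq_zero {N c : ℕ} (ω : D [⋀^Fin N]→ₗ[k] k) {i : L → D} {j : M → D}
    (hij : ∀ u, ∃ a b, u = i a + j b)
    (hω : ∀ (x : List L) (y : List M), c ≤ x.length → ev ω (x.map i ++ y.map j) = 0)
    (x : List L) (l : List D) (hx : c ≤ x.length) : ev ω (x.map i ++ l) = 0 := by
  -- The list `y` collects the M-components already split off.
  suffices H : ∀ (l : List D) (x : List L) (y : List M), c ≤ x.length →
      ev ω ((x.map i ++ y.map j) ++ l) = 0 by
    simpa using H l x [] hx
  intro l
  induction l with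
  | nil => intro x y hx; simpa using hω x y hx
  | cons u l ih =>
    intro x y hx
    obtain ⟨a, b, rfl⟩ := hij u
    have h1 := ih (a :: x) y (by simp; omega)
    have h2 := ih x (y ++ [b]) hx
    simp only [List.map_cons, List.cons_append] at h1
    simp only [List.map_append, List.map_cons, List.map_nil] at h2
    rw [ev_append_cons_add, ev_append_cons, h1, smul_zero, zero_add, ← h2]
    simp

end Vanishing

section Multi

variable {k : Type*} [Field k]
variable {W : Type*} [AddCommGroup W] [Module k W] {M : Type*} [AddCommGroup M] [Module k M]

/-- The alternating maps attached to a family of linear forms on an exterior power. -/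
noncomputable def multiForm {q : ℕ} (Φ : W →ₗ[k] ⋀[k]^q M →ₗ[k] k) : W →ₗ[k] M [⋀^Fin q]→ₗ[k] k :=
  exteriorPower.alternatingMapLinearEquiv.symm.toLinearMap ∘ₗ Φ

theorem multiForm_apply {q : ℕ} (Φ : W →ₗ[k] ⋀[k]^q M →ₗ[k] k) (w : W) (a : Fin q → M) :
    multiForm Φ w a = Φ w (exteriorPower.ιMulti k q a) := rfl

theorem ev_multiForm {q : ℕ} (Φ : W →ₗ[k] ⋀[k]^q M →ₗ[k] k) (w : W) (a : List M) :
    ev (multiForm Φ w) a = Φ w (ev (exteriorPower.ιMulti k q) a) :=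
  ev_comp (Φ w) (exteriorPower.ιMulti k q) a

theorem ev_alternatingMapLinearEquiv_symm {q : ℕ} (φ : ⋀[k]^q M →ₗ[k] W) (a : List M) :
    ev (exteriorPower.alternatingMapLinearEquiv.symm φ) a =
      φ (ev (exteriorPower.ιMulti k q) a) :=
  ev_comp φ (exteriorPower.ιMulti k q) a

theorem ceHom_ev {L : Type*} [LieRing L] [LieAlgebra k L] [CharZero k] {m : ℕ}
    (ρ : L →ₗ[k] W →ₗ[k] W) (φ : ⋀[k]^(m + 1) L →ₗ[k] W) (x : List L) :
    ev (ceD ρ (exteriorPower.alternatingMapLinearEquiv.symm φ)) x =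
      ceHom m ρ φ (ev (exteriorPower.ιMulti k (m + 2)) x) := by
  rw [← ev_alternatingMapLinearEquiv_symm, ceHom]
  simp

end Multi

/-! ### Scalar forms on the Drinfeld double and their coboundary. -/

namespace LieBialgebra

variable {k : Type u} {g : Type v} [Field k] [LieRing g] [LieAlgebra k g]
  [FiniteDimensional k g] (B : LieBialgebra k g)

/-- The Drinfeld double of a Lie bialgebra. -/
abbrev Double : Type (max u v) := Bicrossed B.isMatchedPair

/-- The inclusion of `g` into the double. -/
def inl : g →ₗ[k] B.Double := LinearMap.inl k g B.DualAlg

/-- The inclusion of `g*` into the double. -/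
def inr : B.DualAlg →ₗ[k] B.Double := LinearMap.inr k g B.DualAlg

theorem eq_inl_add_inr (u : B.Double) : u = B.inl u.1 + B.inr u.2 :=
  (congrArg₂ Prod.mk (add_zero u.1) (zero_add u.2)).symm

theorem inl_lie_inl (x y : g) : ⁅B.inl x, B.inl y⁆ = B.inl ⁅x, y⁆ := by
  change ((⁅x, y⁆ + (B.coadRight 0 y - B.coadRight 0 x),
    B.coadLeft x 0 - B.coadLeft y 0 + ⁅(0 : B.DualAlg), (0 : B.DualAlg)⁆) : g × B.DualAlg) =
    (⁅x, y⁆, 0)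
  simp

theorem inr_lie_inr (a b : B.DualAlg) : ⁅B.inr a, B.inr b⁆ = B.inr ⁅a, b⁆ := by
  change ((⁅(0 : g), (0 : g)⁆ + (B.coadRight a 0 - B.coadRight b 0),
    B.coadLeft 0 b - B.coadLeft 0 a + ⁅a, b⁆) : g × B.DualAlg) = (0, ⁅a, b⁆)
  simp

theorem inl_lie_inr (x : g) (a : B.DualAlg) :
    ⁅B.inl x, B.inr a⁆ = B.inr (B.coadLeft x a) + B.inl (-B.coadRight a x) := by
  change ((⁅x, (0 : g)⁆ + (B.coadRight 0 0 - B.coadRight a x),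
    B.coadLeft x a - B.coadLeft 0 0 + ⁅(0 : B.DualAlg), a⁆) : g × B.DualAlg) =
    (0 + -B.coadRight a x, B.coadLeft x a + 0)
  simp

theorem inr_lie_inl (a : B.DualAlg) (x : g) :
    ⁅B.inr a, B.inl x⁆ = B.inl (B.coadRight a x) + B.inr (-B.coadLeft x a) := by
  rw [← lie_skew, inl_lie_inr, neg_add, map_neg B.inl, neg_neg, map_neg B.inr, add_comm]

theorem eq_of_ev {W : Type*} [AddCommGroup W] [Module k W] {n : ℕ} {f f' : B.Double [⋀^Fin n]→ₗ[k] W}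
    (hf : ∀ (x : List g) (y : List B.DualAlg),
      ev f (x.map B.inl ++ y.map B.inr) = ev f' (x.map B.inl ++ y.map B.inr)) : f = f' :=
  eq_of_ev_inl_inr (g := g) (h := B.DualAlg) hf

/-- The form `(x₁, …, x_p, α₁, …, α_q) ↦ ⟨α₁ ∧ … ∧ α_q, ξ (x₁ ∧ … ∧ x_p)⟩` on the double. -/
noncomputable def formOf {p q n : ℕ} (e : p + q = n) (ξ : ⋀[k]^p g →ₗ[k] ⋀[k]^q g) :
    B.Double [⋀^Fin n]→ₗ[k] k :=
  extendSum k e ((B.pairing q).toLinearMap.flip ∘ₗ ξ)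

theorem ev_formOf {p q n : ℕ} (e : p + q = n) (ξ : ⋀[k]^p g →ₗ[k] ⋀[k]^q g) (x : List g)
    (y : List B.DualAlg) : ev (B.formOf e ξ) (x.map B.inl ++ y.map B.inr) =
      B.pairing q (ev (exteriorPower.ιMulti k q) y) (ξ (ev (exteriorPower.ιMulti k p) x)) :=
  ev_extendSum e ((B.pairing q).toLinearMap.flip ∘ₗ ξ) x y

/-- The sign (-1)^{pq} in ξ* is the sign of interchanging the two blocks. Read with the covectors
first, the form of ξ is therefore built from ξ* in the same way, and g and g* play symmetric roles.
-/
theorem ev_formOf_swap {p q n : ℕ} (e : p + q = n) (ξ : ⋀[k]^p g →ₗ[k] ⋀[k]^q g) (x : List g)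
    (y : List B.DualAlg) : ev (B.formOf e ξ) (y.map B.inr ++ x.map B.inl) =
      B.pairing p (B.transposeHom p q ξ (ev (exteriorPower.ιMulti k q) y))
        (ev (exteriorPower.ιMulti k p) x) := by
  rw [ev_append_comm, ev_formOf, transposeHom_apply, List.length_map, List.length_map]
  by_cases hx : x.length = p
  · by_cases hy : y.length = q
    · subst hx hy
      rw [mul_comm, zsmul_eq_mul]
      simp
    · simp [ev_of_length_ne (exteriorPower.ιMulti k q) hy]
  · simp [ev_of_length_ne (exteriorPower.ιMulti k p) hx]

variable [CharZero k]

/-- This is `ev_ced_mixed` with g acting on forms on g*: under the pairing, the adjoint action on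
⋀^q g is minus the coadjoint derivation on covectors. -/
theorem ev_ced_formOf_left {a q n : ℕ} (e : a + 1 + q = n) (e' : a + 2 + q = n + 1)
    (ξ : ⋀[k]^(a + 1) g →ₗ[k] ⋀[k]^q g) (x : List g) (hx : a + 2 ≤ x.length)
    (y : List B.DualAlg) :
    ev (ced 0 n (B.formOf e ξ)) (x.map B.inl ++ y.map B.inr) =
      ev (B.formOf e' (B.dLeft a q ξ)) (x.map B.inl ++ y.map B.inr) := by
  rw [ev_formOf, ev_ced_mixed (m := a) (q := q) B.inl B.inr (fun x => B.coadLeft x)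
    (fun x a => -B.coadRight a x) (extDer q ∘ₗ lieBr k g)
    (multiForm (B.pairing q).toLinearMap.flip) B.inl_lie_inl B.inl_lie_inr ?_
    (exteriorPower.alternatingMapLinearEquiv.symm ξ) (B.formOf e ξ) ?_ ?_ x hx y, ev_multiForm,
    ceHom_ev]
  · rfl
  · intro x w
    ext a
    simp only [LinearMap.comp_apply, multiForm_apply, AlternatingMap.neg_apply, derivAlt_apply,
      LinearMap.flip_apply, LinearEquiv.coe_coe, pairing_extDer_coadLeft, extDer_ιMulti, map_sum,
      LinearMap.sum_apply]
  · intro x y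
    rw [ev_formOf, ev_multiForm, ev_alternatingMapLinearEquiv_symm]
    rfl
  · refine ev_map_append_eq_zero _ (fun u => ⟨_, _, B.eq_inl_add_inr u⟩) fun x y hx => ?_
    rw [ev_formOf, ev_of_length_ne (exteriorPower.ιMulti k (a + 1)) (by omega), map_zero, map_zero]

/-- The mirror image of `ev_ced_formOf_left`, with g* acting on forms on g and ξ* in place of ξ. -/
theorem ev_ced_formOf_right {p b n : ℕ} (e : p + (b + 1) = n) (e' : p + (b + 2) = n + 1)
    (ξ : ⋀[k]^p g →ₗ[k] ⋀[k]^(b + 1) g) (x : List g)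
    (y : List B.DualAlg) (hy : b + 2 ≤ y.length) :
    ev (ced 0 n (B.formOf e ξ)) (y.map B.inr ++ x.map B.inl) =
      ev (B.formOf e' (B.dRight p b ξ)) (y.map B.inr ++ x.map B.inl) := by
  rw [ev_formOf_swap, ev_ced_mixed (m := b) (q := p) B.inr B.inl (fun a => B.coadRight a)
    (fun a x => -B.coadLeft x a) (extDer p ∘ₗ lieBr k B.DualAlg)
    (multiForm (B.pairing p).toLinearMap) B.inr_lie_inr B.inr_lie_inl ?_
    (exteriorPower.alternatingMapLinearEquiv.symm (B.transposeHom p (b + 1) ξ)) (B.formOf e ξ)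
    ?_ ?_ y hy x, ev_multiForm, ceHom_ev]
  · simp [dRight]
  · intro x w
    ext a
    simp only [LinearMap.comp_apply, multiForm_apply, AlternatingMap.neg_apply, derivAlt_apply,
      LinearEquiv.coe_coe, pairing_extDer_lie, extDer_ιMulti, map_sum]
  · intro y x
    rw [ev_formOf_swap, ev_multiForm, ev_alternatingMapLinearEquiv_symm]
    rfl
  · refine ev_map_append_eq_zero _
      (fun u => ⟨_, _, (B.eq_inl_add_inr u).trans (add_comm _ _)⟩) fun y x hy => ?_
    rw [ev_formOf_swap, ev_of_length_ne (exteriorPower.ιMulti k (b + 1)) (by omega), map_zero,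
      map_zero, LinearMap.zero_apply]

/-- The trivial coefficients coboundary of the double is the sum of the coboundaries of `g` and
`g*`. -/
theorem ced_formOf {a b n : ℕ} (e : a + 1 + (b + 1) = n) (e₁ : a + 2 + (b + 1) = n + 1)
    (e₂ : a + 1 + (b + 2) = n + 1) (ξ : ⋀[k]^(a + 1) g →ₗ[k] ⋀[k]^(b + 1) g) :
    ced 0 n (B.formOf e ξ) =
      B.formOf e₁ (B.dLeft a (b + 1) ξ) + B.formOf e₂ (B.dRight (a + 1) b ξ) := by
  refine B.eq_of_ev fun x y => ?_
  rw [ev_add]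
  by_cases hn : x.length + y.length = n + 1
  -- There are a + b + 3 entries in all, so either at least a + 2 lie in g or at least b + 2 lie in
  -- g*, never both. In each case the other summand vanishes for lack of entries.
  · by_cases hx : a + 2 ≤ x.length
    · rw [ev_ced_formOf_left B e e₁ ξ x hx, ev_formOf B e₂,
        ev_of_length_ne (exteriorPower.ιMulti k (a + 1)) (by omega), map_zero, map_zero, add_zero]
    · rw [ev_append_comm, ev_ced_formOf_right B e e₂ ξ x y (by omega), ev_formOf B e₁,
        ev_of_length_ne (exteriorPower.ιMulti k (a + 2)) (by omega), map_zero, map_zero, zero_add,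
        ev_append_comm (B.formOf e₂ _) (x.map B.inl)]
  · rw [ev_of_length_ne _ (by simpa using hn), ev_of_length_ne _ (by simpa using hn),
      ev_of_length_ne _ (by simpa using hn), add_zero]

end LieBialgebra

/-! ### Coboundaries of cochains obtained by contracting a form with an invariant pairing. -/

section Contraction

variable {k : Type*} [Field k]
variable {W W' : Type*} [AddCommGroup W] [Module k W] [AddCommGroup W'] [Module k W']

theorem coe_ev_ιMulti {M : Type*} [AddCommGroup M] [Module k M] {n : ℕ} (x : List M)
    (hx : x.length = n) :
    ((ev (exteriorPower.ιMulti k n) x : ⋀[k]^n M) : ExteriorAlgebra k M) =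
      (x.map (ExteriorAlgebra.ι k)).prod := by
  subst hx
  rw [ev, dif_pos rfl, exteriorPower.ιMulti_apply_coe, ExteriorAlgebra.ιMulti_apply]
  congr 1
  conv_rhs => rw [← List.ofFn_get x, List.map_ofFn]
  rfl

theorem wedgeRight_ev {M : Type*} [AddCommGroup M] [Module k M] (n : ℕ) (x : List M) (a : M) :
    wedgeRight n (ev (exteriorPower.ιMulti k n) x) a =
      (-1 : ℤ) ^ n • ev (exteriorPower.ιMulti k (n + 1)) (a :: x) := by
  by_cases hx : x.length = n
  · have h := ev_append_cons (exteriorPower.ιMulti k (n + 1)) x [] a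
    rw [List.append_nil, hx] at h
    rw [← h]
    apply Subtype.ext
    rw [coe_ev_ιMulti (x ++ [a]) (by simp [hx])]
    change ((ev (exteriorPower.ιMulti k n) x : ⋀[k]^n M) : ExteriorAlgebra k M) * _ = _
    rw [coe_ev_ιMulti x hx]
    simp
  · rw [ev_of_length_ne _ hx, ev_of_length_ne _ (by simpa using hx), map_zero,
      LinearMap.zero_apply, smul_zero]

theorem ev_smul {V : Type*} [AddCommGroup V] [Module k V] {n : ℕ} (c : k)
    (f : V [⋀^Fin n]→ₗ[k] W) (l : List V) : ev (c • f) l = c • ev f l := by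
  by_cases h : l.length = n <;> simp [ev, h]

variable [CharZero k] {D : Type*} [LieRing D] [LieAlgebra k D]

theorem compAlternatingMap_ceD_zero {n : ℕ} (T : W →ₗ[k] W') (F : D [⋀^Fin (n + 1)]→ₗ[k] W) :
    T.compAlternatingMap (ceD 0 F) = ceD 0 (T.compAlternatingMap F) := by
  ext x
  simp [ceFun]

/-- If an invariant pairing identifies `F` with the contractions of a form `ω`, then it identifies
the coboundary of `F` with the contractions of the coboundary of `ω`. -/
theorem compAlternatingMap_ceD_eq_contraction {n : ℕ} (β : D →ₗ[k] D →ₗ[k] k)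
    (hβ : ∀ u v w : D, β v ⁅w, u⁆ = -β ⁅w, v⁆ u)
    (F : D [⋀^Fin (n + 1)]→ₗ[k] D) (ω : D [⋀^Fin (n + 2)]→ₗ[k] k) (c : k)
    (hF : ∀ v, (β v).compAlternatingMap F = c • ω.curryLeft v) (v : D) :
    (β v).compAlternatingMap (ceD (lieBr k D) F) = -c • (ced 0 (n + 2) ω).curryLeft v := by
  -- Invariance moves the action of xᵢ from the value of F to v, and the hypothesis on F at [v, xᵢ]
  -- turns the sum into a derivation of ω.
  have h1 : (β v).compAlternatingMap (ceCoef (lieBr k D) F) = c • derivAlt (lieBr k D v) ω := by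
    ext x
    rw [derivAlt_eq_alternatizeUncurryFin, AlternatingMap.smul_apply,
      AlternatingMap.alternatizeUncurryFin_apply, LinearMap.compAlternatingMap_apply, ceCoef_apply,
      map_sum, Finset.smul_sum]
    refine Finset.sum_congr rfl fun i _ => ?_
    rw [map_zsmul, smul_comm c]
    congr 1
    have := congrArg (fun G => G (i.removeNth x)) (hF ⁅v, x i⁆)
    refine Eq.trans ?_ this
    change β v ⁅x i, F _⁆ = β ⁅v, x i⁆ (F _)
    rw [hβ, ← LinearMap.neg_apply, ← map_neg, lie_skew]
  -- Cartan's formula, with L_v equal to minus the derivation by ad v on scalar forms.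
  have h2 : (ced 0 (n + 2) ω).curryLeft v =
      -derivAlt (lieBr k D v) ω - ceD 0 (ω.curryLeft v) := by
    rw [curryLeft_ced_succ, ced]
    congr 1
    ext x; simp [lieAct]
  have h3 : (β v).compAlternatingMap (ceD (lieBr k D) F) =
      (β v).compAlternatingMap (ceCoef (lieBr k D) F) + (β v).compAlternatingMap (ceD 0 F) := by
    rw [ceD_eq_coef_add]; ext x; simp
  rw [h3, h1, compAlternatingMap_ceD_zero, hF, h2, map_smul, smul_sub, neg_smul, neg_smul,
    smul_neg, neg_neg, sub_neg_eq_add]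

end Contraction

/-! ### The invariant pairing of the double, and Ψ as contraction of a form. -/

namespace LieBialgebra

variable {k : Type u} {g : Type v} [Field k] [LieRing g] [LieAlgebra k g]
  [FiniteDimensional k g] (B : LieBialgebra k g)

/-- The pairing `((x, α), (y, β)) ↦ α(y) + β(x)`. -/
noncomputable def pairForm : (g × B.DualAlg) →ₗ[k] (g × B.DualAlg) →ₗ[k] k :=
  LinearMap.mk₂ k (fun u v : g × B.DualAlg => B.toDual u.2 v.1 + B.toDual v.2 u.1)
    (fun u u' v => by simp; ring) (fun c u v => by simp; ring)
    (fun u v v' => by simp; ring) (fun c u v => by simp; ring)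

/-- The invariant pairing `((x, α), (y, β)) ↦ α(y) + β(x)` of the double. -/
noncomputable def pairD : B.Double →ₗ[k] B.Double →ₗ[k] k := B.pairForm

theorem pairD_apply (u v : B.Double) : B.pairD u v = B.toDual u.2 v.1 + B.toDual v.2 u.1 := rfl

theorem pairD_inl (x : g) (v : B.Double) : B.pairD (B.inl x) v = B.toDual v.2 x := by
  rw [pairD_apply]
  change B.toDual 0 v.1 + B.toDual v.2 x = _
  simp

theorem pairD_inr (a : B.DualAlg) (v : B.Double) : B.pairD (B.inr a) v = B.toDual a v.1 := by
  rw [pairD_apply]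
  change B.toDual a v.1 + B.toDual v.2 0 = _
  simp

theorem eq_of_pairD {u v : B.Double} (h : ∀ w, B.pairD w u = B.pairD w v) : u = v := by
  refine Prod.ext (B.ext_toDual fun β => ?_) (B.toDual.injective (LinearMap.ext fun x => ?_))
  · simpa only [pairD_inr] using h (B.inr β)
  · simpa only [pairD_inl] using h (B.inl x)

/-- The defining relations of the coadjoint actions turn every mixed term into a covector evaluated
on a bracket of g, or a bracket of covectors evaluated on a vector. These then cancel by
skew-symmetry. -/
theorem pairD_lie (u v w : B.Double) : B.pairD v ⁅w, u⁆ = -B.pairD ⁅w, v⁆ u := by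
  obtain ⟨x, a⟩ := u
  obtain ⟨y, b⟩ := v
  obtain ⟨z, c⟩ := w
  change B.toDual b (⁅z, x⁆ + (B.coadRight c x - B.coadRight a z)) +
    B.toDual (B.coadLeft z a - B.coadLeft x c + ⁅c, a⁆) y =
    -(B.toDual (B.coadLeft z b - B.coadLeft y c + ⁅c, b⁆) x +
      B.toDual a (⁅z, y⁆ + (B.coadRight c y - B.coadRight b z)))
  simp only [map_add, map_sub, LinearMap.add_apply, LinearMap.sub_apply, coadLeft_apply,
    coadRight_apply]
  rw [← lie_skew x y, ← lie_skew a b]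
  simp only [map_neg, LinearMap.neg_apply]
  ring

/-- The map `Ψ` on the double. -/
noncomputable def psiDouble {a b n : ℕ} (e : a + b + 1 = n)
    (ξ : ⋀[k]^(a + 1) g →ₗ[k] ⋀[k]^(b + 1) g) : B.Double [⋀^Fin n]→ₗ[k] B.Double :=
  B.psiHom e ξ

theorem ev_psiDouble {a b n : ℕ} (e : a + b + 1 = n) (ξ : ⋀[k]^(a + 1) g →ₗ[k] ⋀[k]^(b + 1) g)
    (x : List g) (y : List B.DualAlg) :
    ev (B.psiDouble e ξ) (x.map B.inl ++ y.map B.inr) =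
      B.inl (B.tilde (a + 1) b ξ (ev (exteriorPower.ιMulti k (a + 1)) x)
        (ev (exteriorPower.ιMulti k b) y)) +
      B.inr (B.bar a (b + 1) ξ (ev (exteriorPower.ιMulti k a) x)
        (ev (exteriorPower.ιMulti k (b + 1)) y)) := by
  refine (ev_add (V := g × B.DualAlg) (W := g × B.DualAlg) _ _ _).trans ?_
  refine congrArg₂ (· + ·) ?_ ?_
  · exact (ev_comp (V := g × B.DualAlg) (W' := g × B.DualAlg) _ _ _).trans
      (congrArg (LinearMap.inl k g B.DualAlg) (ev_extendSum _ _ x y))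
  · exact (ev_comp (V := g × B.DualAlg) (W' := g × B.DualAlg) _ _ _).trans
      (congrArg (LinearMap.inr k g B.DualAlg) (ev_extendSum _ _ x y))

/-- Pairing with a vector of g sees only ξ̄, and pairing with a covector sees only ξ̃. Both are
contractions of the same form, and the signs in their definitions make the factor (-1)ⁿ the same for
both. -/
theorem pairD_psiDouble {a b n : ℕ} (e : a + b + 1 = n) (e' : a + 1 + (b + 1) = n + 1)
    (ξ : ⋀[k]^(a + 1) g →ₗ[k] ⋀[k]^(b + 1) g) (v : B.Double) :
    (B.pairD v).compAlternatingMap (B.psiDouble e ξ) =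
      (-1 : k) ^ n • (B.formOf e' ξ).curryLeft v := by
  have hinl : ∀ x, (B.pairD (B.inl x)).compAlternatingMap (B.psiDouble e ξ) =
      (-1 : k) ^ n • (B.formOf e' ξ).curryLeft (B.inl x) := by
    intro z
    refine B.eq_of_ev fun x y => ?_
    have h1 := B.ev_formOf e' ξ (z :: x) y
    rw [List.map_cons, List.cons_append, ev_cons] at h1
    rw [ev_comp, ev_psiDouble, ev_smul, h1, pairD_inl]
    refine (congrArg (fun β => B.toDual β z) (zero_add (B.bar a (b + 1) ξ _ _))).trans ?_
    rw [bar_apply, transposeHom_apply, wedgeRight_ev, map_zsmul, map_zsmul, zsmul_eq_mul, ← e,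
      smul_eq_mul, ← mul_assoc, ← mul_assoc]
    congr 1
    push_cast
    -- The exponents come from ξ̄, from ξ*, and from moving z in front of the other a vectors.
    rw [← pow_add, ← pow_add,
      show a * (b + 1) + (a + 1) * (b + 1) + a = 2 * (a * (b + 1)) + (a + b + 1) by ring, pow_add,
      pow_mul, neg_one_sq, one_pow, one_mul]
  have hinr : ∀ a, (B.pairD (B.inr a)).compAlternatingMap (B.psiDouble e ξ) =
      (-1 : k) ^ n • (B.formOf e' ξ).curryLeft (B.inr a) := by
    intro α
    refine B.eq_of_ev fun x y => ?_
    have h1 := B.ev_formOf e' ξ x (α :: y)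
    rw [List.map_cons, ev_append_cons, ev_cons, List.length_map] at h1
    rw [ev_comp, ev_psiDouble, ev_smul, pairD_inr]
    refine (congrArg (fun z => B.toDual α z) (add_zero (B.tilde (a + 1) b ξ _ _))).trans ?_
    rw [tilde_apply, wedgeRight_ev, map_zsmul, LinearMap.smul_apply]
    -- Moving α past the vectors of g costs (-1) to the length of `x`, which is the required sign
    -- only for length a + 1. For other lengths both sides are zero.
    by_cases hx : x.length = a + 1
    · rw [← h1, hx, zsmul_eq_mul, zsmul_eq_mul, smul_eq_mul, ← mul_assoc]
      congr 1
      push_cast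
      rw [← pow_add, ← e, show b + (a + 1) = a + b + 1 by ring]
    · rw [ev_of_length_ne _ hx, map_zero, map_zero] at h1 ⊢
      rw [neg_one_pow_smul_cancel (h1.trans (smul_zero _).symm), smul_zero, smul_zero]
  rw [B.eq_inl_add_inr v, map_add, map_add, smul_add, ← hinl, ← hinr]
  ext x
  simp

variable [CharZero k]

/-- By nondegeneracy it suffices to pair with v. The contraction lemma with c = (-1)^(n+1) produces
the factor -c = (-1)^(n+2), exactly the one that `pairD_psiDouble` requires one degree higher. -/
theorem ceD_psiDouble {a b n : ℕ} (e : a + b + 1 = n + 1) (e₁ : a + 1 + b + 1 = n + 2)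
    (e₂ : a + (b + 1) + 1 = n + 2) (ξ : ⋀[k]^(a + 1) g →ₗ[k] ⋀[k]^(b + 1) g) :
    ceD (lieBr k B.Double) (B.psiDouble e ξ) =
      B.psiDouble e₁ (B.dLeft a (b + 1) ξ) + B.psiDouble e₂ (B.dRight (a + 1) b ξ) := by
  ext x
  refine B.eq_of_pairD fun v => ?_
  have h := compAlternatingMap_ceD_eq_contraction B.pairD B.pairD_lie (B.psiDouble e ξ)
    (B.formOf (by omega) ξ) _ (B.pairD_psiDouble e (by omega) ξ) v
  rw [B.ced_formOf _ (by omega) (by omega), AlternatingMap.curryLeft_add, LinearMap.add_apply,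
    smul_add, neg_eq_neg_one_mul, ← pow_succ', ← pairD_psiDouble B e₁, ← pairD_psiDouble B e₂] at h
  have h' := congrArg (fun G => G x) h
  refine h'.trans ?_
  simp

theorem mpDelta_psiHom {a b n : ℕ} (e : a + b + 1 = n) (e₁ : a + 1 + b + 1 = n + 1)
    (e₂ : a + (b + 1) + 1 = n + 1) (ξ : ⋀[k]^(a + 1) g →ₗ[k] ⋀[k]^(b + 1) g) :
    mpDelta B.coadLeft B.coadRight n (B.psiHom e ξ) =
      B.psiHom e₁ (B.dLeft a (b + 1) ξ) + B.psiHom e₂ (B.dRight (a + 1) b ξ) := by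
  obtain rfl | ⟨n, rfl⟩ : n = 0 ∨ ∃ m, n = m + 1 := by cases n <;> simp
  · omega
  · exact (mpDelta_eq_ced B.isMatchedPair (n + 1) (B.psiHom e ξ)).trans
      (B.ceD_psiDouble e e₁ e₂ ξ)

end LieBialgebra

/-! ### Injectivity of Ψ, the cochain map property and the square of δ_LieBi. -/

namespace LieBialgebra

variable {k : Type u} {g : Type v} [Field k] [LieRing g] [LieAlgebra k g]
  [FiniteDimensional k g] (B : LieBialgebra k g)

theorem eq_zero_of_pairing {p q : ℕ} (ξ : ⋀[k]^p g →ₗ[k] ⋀[k]^q g)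
    (h : ∀ (x : Fin p → g) (y : Fin q → B.DualAlg),
      B.pairing q (exteriorPower.ιMulti k q y) (ξ (exteriorPower.ιMulti k p x)) = 0) : ξ = 0 := by
  refine exteriorPower.linearMap_ext (AlternatingMap.ext fun x => ?_)
  refine (Module.forall_dual_apply_eq_zero_iff k _).1 fun φ => ?_
  obtain ⟨Y, rfl⟩ := (B.pairing q).surjective φ
  have : (B.pairing q).toLinearMap.flip (ξ (exteriorPower.ιMulti k p x)) = 0 :=
    exteriorPower.linearMap_ext (AlternatingMap.ext fun y => h x y)
  exact LinearMap.congr_fun this Y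

theorem psi_val {n : ℕ} (ξ : B.Cochain n) :
    MPCochain.val B.coadLeft B.coadRight n (B.psi n ξ) =
      ∑ i : Index n, B.psiHom i.2 (B.comp i ξ) := by
  rw [psi, LinearMap.sum_apply, map_sum]
  rfl

theorem val_injective (n : ℕ) :
    Function.Injective (MPCochain.val B.coadLeft B.coadRight n) := Subtype.val_injective

/-- Pairing with all vectors recovers the total form of ξ up to a sign. Its components have distinct
bidegrees, so each is read off from tuples with the matching number of vectors and covectors. -/
theorem psi_injective (n : ℕ) : Function.Injective (B.psi n) := by
  rw [injective_iff_map_eq_zero]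
  intro ξ hξ
  have hval : ∑ i : Index n, B.psiDouble i.2 (B.comp i ξ) = 0 :=
    (B.psi_val ξ).symm.trans ((congrArg _ hξ).trans (map_zero _))
  have hform : ∑ i : Index n, B.formOf (n := n + 1) (by have := i.2; omega) (B.comp i ξ) = 0 := by
    refine AlternatingMap.ext fun w => ?_
    have h := congrArg (fun F => B.pairD (w 0) (evHom k n (List.ofFn (Fin.tail w)) F)) hval
    simp only [map_sum, map_zero, evHom_apply, ev_ofFn] at h
    have hi (i : Index n) : B.pairD (w 0) (B.psiDouble i.2 (B.comp i ξ) (Fin.tail w)) =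
        (-1 : k) ^ n • B.formOf (by have := i.2; omega) (B.comp i ξ) w := by
      have := congrArg (fun F => F (Fin.tail w))
        (B.pairD_psiDouble i.2 (by have := i.2; omega) (B.comp i ξ) (w 0))
      simpa [Matrix.vecCons] using this
    rw [Finset.sum_congr rfl fun i _ => hi i, ← Finset.smul_sum] at h
    have h0 := (smul_eq_zero.1 h).resolve_left (by simp)
    rw [← ev_ofFn, ← evHom_apply, map_sum]
    simpa only [evHom_apply, ev_ofFn, AlternatingMap.zero_apply] using h0
  funext i
  refine B.eq_zero_of_pairing _ fun x y => ?_
  have h := congrArg (evHom k (n + 1) ((List.ofFn x).map B.inl ++ (List.ofFn y).map B.inr)) hform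
  rw [map_sum, map_zero, Finset.sum_eq_single i] at h
  · rw [evHom_apply, ev_formOf, ev_ofFn, ev_ofFn] at h
    exact h
  · intro j _ hji
    rw [evHom_apply, ev_formOf, ev_of_length_ne (exteriorPower.ιMulti k (j.1.1 + 1)), map_zero,
      map_zero]
    intro hl
    rw [List.length_ofFn] at hl
    have := i.2
    have := j.2
    exact hji (Subtype.ext (Prod.ext (by omega) (by omega)))
  · simp

variable [CharZero k]

/-- Reindexing: indices with first entry 0 contribute nothing, and every other index arises from
exactly one j by raising its first entry. -/
theorem sum_dFst {n : ℕ} (ξ : B.Cochain n) {M : Type*} [AddCommGroup M]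
    (F : (i : Index (n + 1)) → (⋀[k]^(i.1.1 + 1) g →ₗ[k] ⋀[k]^(i.1.2 + 1) g) →+ M) :
    ∑ i, F i (B.dFst n i ξ) = ∑ j : Index n, F ⟨(j.1.1 + 1, j.1.2), by have := j.2; simp; omega⟩
      (B.dLeft j.1.1 (j.1.2 + 1) (B.comp j ξ)) := by
  symm
  refine Finset.sum_of_injOn (fun j : Index n => ⟨(j.1.1 + 1, j.1.2), by have := j.2; simp; omega⟩)
    ?_ (by simp) ?_ (fun j _ => rfl)
  · rintro ⟨⟨a, b⟩, _⟩ - ⟨⟨a', b'⟩, _⟩ - h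
    simpa using h
  · rintro ⟨⟨_ | a, b⟩, hi⟩ - h
    · exact map_zero _
    · exact absurd ⟨⟨(a, b), by simp at hi ⊢; omega⟩, by simp, rfl⟩ h

theorem sum_dSnd {n : ℕ} (ξ : B.Cochain n) {M : Type*} [AddCommGroup M]
    (F : (i : Index (n + 1)) → (⋀[k]^(i.1.1 + 1) g →ₗ[k] ⋀[k]^(i.1.2 + 1) g) →+ M) :
    ∑ i, F i (B.dSnd n i ξ) = ∑ j : Index n, F ⟨(j.1.1, j.1.2 + 1), by have := j.2; simp; omega⟩
      (B.dRight (j.1.1 + 1) j.1.2 (B.comp j ξ)) := by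
  symm
  refine Finset.sum_of_injOn (fun j : Index n => ⟨(j.1.1, j.1.2 + 1), by have := j.2; simp; omega⟩)
    ?_ (by simp) ?_ (fun j _ => rfl)
  · rintro ⟨⟨a, b⟩, _⟩ - ⟨⟨a', b'⟩, _⟩ - h
    simpa using h
  · rintro ⟨⟨a, _ | b⟩, hi⟩ - h
    · exact map_zero _
    · exact absurd ⟨⟨(a, b), by simp at hi ⊢; omega⟩, by simp, rfl⟩ h

theorem mpD_comp_psi (n : ℕ) : B.mpD n ∘ₗ B.psi n = B.psi (n + 1) ∘ₗ B.d n := by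
  refine LinearMap.ext fun ξ => B.val_injective _ ?_
  have hR : MPCochain.val B.coadLeft B.coadRight (n + 1) (B.psi (n + 1) (B.d n ξ)) =
      ∑ i, B.psiHom i.2 (B.dFst n i ξ) + ∑ i, B.psiHom i.2 (B.dSnd n i ξ) := by
    rw [psi_val, ← Finset.sum_add_distrib]
    refine Finset.sum_congr rfl fun i _ => ?_
    exact congrArg Subtype.val (map_add (B.psiComponent i) (B.dFst n i ξ) (B.dSnd n i ξ))
  let F (i : Index (n + 1)) := (MPCochain.val B.coadLeft B.coadRight (n + 1) ∘ₗ
    B.psiComponent i).toAddMonoidHom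
  rw [LinearMap.comp_apply, LinearMap.comp_apply, mpD_val, psi_val, hR, map_sum]
  refine Eq.trans ?_ (congrArg₂ (· + ·) (B.sum_dFst ξ F) (B.sum_dSnd ξ F)).symm
  rw [← Finset.sum_add_distrib]
  exact Finset.sum_congr rfl fun i _ => B.mpDelta_psiHom i.2 _ _ (B.comp i ξ)

/-- Since Ψ d d = δ_MPL δ_MPL Ψ = 0 and Ψ is injective, no separate study of δ_g, δ_{g*} and their
anticommutation is needed. -/
theorem d_comp_d (n : ℕ) : B.d (n + 1) ∘ₗ B.d n = 0 := by
  refine LinearMap.ext fun ξ => B.psi_injective (n + 2) ?_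
  have h1 := LinearMap.congr_fun (B.mpD_comp_psi (n + 1)) (B.d n ξ)
  have h2 := LinearMap.congr_fun (B.mpD_comp_psi n) ξ
  have h3 := LinearMap.congr_fun (mpD_comp_mpD B.isMatchedPair n) (B.psi n ξ)
  simp only [LinearMap.comp_apply] at h1 h2 h3
  rw [← h2] at h1
  rw [LinearMap.comp_apply, ← h1, h3]
  simp

end LieBialgebra

/-! ### The induced maps on cohomology. -/

theorem existsUnique_induces {k : Type u} [Field k] {K L : CochainComplex (ModuleCat.{w} k) ℕ}
    (F : K ⟶ L) : ∃! Φ : ∀ n, K.homology n ⟶ L.homology n, Induces F Φ := by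
  refine ⟨fun n => HomologicalComplex.homologyMap F n,
    fun n => HomologicalComplex.homologyπ_naturality F n, fun Φ hΦ => funext fun n => ?_⟩
  -- Every class comes from a cocycle, so the values on cocycle classes determine Φ.
  rw [← cancel_epi (K.homologyπ n), hΦ n, HomologicalComplex.homologyπ_naturality]

end LieMP

theorem mainTheorem5 {k : Type u} {g : Type v} [Field k] [CharZero k] [LieRing g]
    [LieAlgebra k g] [FiniteDimensional k g] (B : LieMP.LieBialgebra k g) :
    LieMP.IsMatchedPair B.coadLeft B.coadRight ∧
    ∃ (hL : ∀ n, B.d (n + 1) ∘ₗ B.d n = 0)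
      (hM : ∀ n, B.mpD (n + 1) ∘ₗ B.mpD n = 0)
      (hΨ : ∀ n, B.mpD n ∘ₗ B.psi n = B.psi (n + 1) ∘ₗ B.d n),
      ∃! Φ : ∀ n, (LieMP.complexOf B.Cochain B.d hL).homology n ⟶
          (LieMP.complexOf B.MPCochain B.mpD hM).homology n,
        LieMP.Induces (LieMP.complexMap hL hM B.psi hΨ) Φ :=
  ⟨B.isMatchedPair, B.d_comp_d, LieMP.mpD_comp_mpD B.isMatchedPair, B.mpD_comp_psi,
    LieMP.existsUnique_induces _⟩
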